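/- **Conventions.** The basic open subsets of the extended plane $\hat{\mathbb C}$ are the open rectangles whose vertices have rational coordinates and the sets $\hat{\mathbb C}-\overline{D_r(0)}$ with $r>0$ rational, where $D_r(z)$ is the open disk with center $z$ and radius $r$; they are indexed effectively by natural numbers. A *name* of a point $z\in\hat{\mathbb C}$ is a sequence that lists (the indices of) all basic open sets that contain $z$, and no others; a real number is named as a point of $\hat{\mathbb C}$. A *name* of a partial function $f$ from $\hat{\mathbb C}$ to $\hat{\mathbb C}$ consists of a set $X\subseteq\mathbb N$ and a code of a Turing machine with a one-way output tape which, given access to the oracle $X$ and any name of any $z\in\operatorname{dom}(f)$ on its input tape, writes a name of $f(z)$ on its output tape when allowed to run indefinitely. A real-valued function $u$ whose domain is an open connected set $D\subseteq\hat{\mathbb C}$ is *harmonic* if it is $C^2$ with $u_{xx}+u_{yy}=0$ on $D-\{\infty\}$ and, in case $\infty\in D$, the function $z\mapsto u(1/z)$ is harmonic on some disk about $0$. Harmonic functions $u,v$ on an open set of the plane are such that $v$ is a *harmonic conjugate* of $u$ if $u_x=v_y$ and $u_y=-v_x$. **Theorem (Computable conjugation).** From a name of a harmonic function $u$ and names of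 $z_0\in\mathbb C$ and $R>0$ such that $\overline{D_R(z_0)}\subseteq\operatorname{dom}(u)$, it is possible to uniformly compute a name of a harmonic conjugate of $u$ with domain $D_R(z_0)$. That is, there is a single Turing machine (without oracle) which, for all such $u,z_0,R$, whenever a name of $u$, a name of $z_0$ and a name of $R$ are written on its input tape, writes on its output tape a name of the function $\tilde u$ with domain $D_R(z_0)$, where $\tilde u$ is the harmonic conjugate of $u$ on $D_R(z_0)$ that vanishes at $z_0$. Moreover, for all $z\in D_R(z_0)$ and all $r$ with $|z-z_0|<r<R$, $$\tilde u(z)=\frac1{2\pi i}\int_0^{2\pi}u(z_0+re^{i\theta})\,\frac{re^{-i\theta}(z-z_0)-re^{i\theta}\,\overline{(z-z_0)}}{|re^{i\theta}-(z-z_0)|^2}\,d\theta .$$ -/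

import Mathlib

open Complex InnerProductSpace

namespace ComputableConjugation

noncomputable section

/-- The extended complex plane. -/
abbrev Sphere : Type := OnePoint ℂ

/-! ### Basic open sets of the extended plane -/

/-- A notation of the rational numbers by natural numbers: `⟨a, ⟨b, d⟩⟩` denotes
`(a - b) / (d + 1)`. Every rational number is denoted. -/
def ratOf (k : ℕ) : ℚ :=
  ((k.unpair.1 : ℚ) - (k.unpair.2.unpair.1 : ℚ)) / ((k.unpair.2.unpair.2 : ℚ) + 1)

/-- A notation of the positive rational numbers: `⟨a, d⟩` denotes `(a + 1) / (d + 1)`. -/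
def posRatOf (k : ℕ) : ℚ := ((k.unpair.1 : ℚ) + 1) / ((k.unpair.2 : ℚ) + 1)

/-- The open rectangle `(a, b) × (c, d)`, as a subset of the extended plane. -/
def openRect (a b c d : ℚ) : Set Sphere :=
  (fun z : ℂ => (z : Sphere)) ''
    {z : ℂ | (a : ℝ) < z.re ∧ z.re < (b : ℝ) ∧ (c : ℝ) < z.im ∧ z.im < (d : ℝ)}

/-- The complement in the extended plane of the closed disk of radius `r` about `0`. -/
def exteriorDisk (r : ℚ) : Set Sphere :=
  ((fun z : ℂ => (z : Sphere)) '' Metric.closedBall (0 : ℂ) (r : ℝ))ᶜ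

/-- The basic open set with index `k`: the indices `⟨0, m⟩` denote the exteriors of disks of
positive rational radius about `0`, the others the rational rectangles. -/
def basicSet (k : ℕ) : Set Sphere :=
  if k.unpair.1 = 0 then exteriorDisk (posRatOf k.unpair.2)
  else
    openRect (ratOf k.unpair.2.unpair.1.unpair.1) (ratOf k.unpair.2.unpair.1.unpair.2)
      (ratOf k.unpair.2.unpair.2.unpair.1) (ratOf k.unpair.2.unpair.2.unpair.2)

/-- `p` is a name of the point `z`: a list (in any order, repetitions allowed) of all the basic
open sets that contain `z`, and of no others. -/
def IsPointName (p : ℕ → ℕ) (z : Sphere) : Prop :=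
  ∀ k : ℕ, (∃ i, p i = k) ↔ z ∈ basicSet k

/-! ### Oracle machines with an infinite input tape and a one-way output tape

The program of a machine is a code of a partial recursive function. It is applied to the pair
(internal state, last reply) and produces the next internal state together with one action: read
the next cell of the input tape, put a question to the oracle, or write a symbol at the end of
the output tape. All the internal work between two such actions is the evaluation of the program;
if that evaluation diverges, then the machine writes nothing more. -/

/-- A configuration of a machine: the internal state, the last reply of the input tape or of the
oracle, the position of the input head, and what has been written on the output tape so far. -/
structure Config where
  state : ℕ
  reply : ℕ
  head : ℕ
  output : List ℕ

/-- The initial configuration. -/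
def Config.init : Config := ⟨0, 0, 0, []⟩

open Classical in
/-- The characteristic function of a set of natural numbers. -/
def bit (X : Set ℕ) (n : ℕ) : ℕ := if n ∈ X then 1 else 0

/-- The effect of the value `⟨s, ⟨t, x⟩⟩` of the program on a configuration: the new state is `s`,
and the action is to read the next input cell (`t = 0`), to ask the oracle whether it contains
`x` (`t = 1`), or to write `x` on the output tape (`2 ≤ t`). -/
def act (X : Set ℕ) (p : ℕ → ℕ) (C : Config) (k : ℕ) : Config :=
  match k.unpair.2.unpair.1 with
  | 0 => ⟨k.unpair.1, p C.head, C.head + 1, C.output⟩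
  | 1 => ⟨k.unpair.1, bit X k.unpair.2.unpair.2, C.head, C.output⟩
  | _ => ⟨k.unpair.1, 0, C.head, C.output ++ [k.unpair.2.unpair.2]⟩

/-- One step of the machine with program `e`, oracle `X` and input tape `p`. -/
def step (e : Nat.Partrec.Code) (X : Set ℕ) (p : ℕ → ℕ) (C : Config) : Part Config :=
  (e.eval (Nat.pair C.state C.reply)).map (act X p C)

/-- The configuration after `t` steps (undefined if the machine hangs before). -/
def run (e : Nat.Partrec.Code) (X : Set ℕ) (p : ℕ → ℕ) : ℕ → Part Config
  | 0 => Part.some Config.init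
  | t + 1 => (run e X p t).bind (step e X p)

/-- When it is allowed to run indefinitely with oracle `X` and input tape `p`, the machine `e`
writes the infinite sequence `q` on its output tape. -/
def Writes (e : Nat.Partrec.Code) (X : Set ℕ) (p q : ℕ → ℕ) : Prop :=
  ∀ n : ℕ, ∃ t : ℕ, ∃ C ∈ run e X p t, C.output[n]? = some (q n)

/-! ### Names of functions -/

/-- The oracle `X` and the machine `e` form a name of the function `f` with domain `D`: with
oracle `X`, the machine turns every name of a point `z` of `D` into a name of `f z`. (A name
carries no information on `D`; the values of `f` off `D` play no role.) -/
def IsFunctionName (X : Set ℕ) (e : Nat.Partrec.Code) (D : Set Sphere) (f : Sphere → Sphere) :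
    Prop :=
  ∀ z ∈ D, ∀ p : ℕ → ℕ, IsPointName p z → ∃ q : ℕ → ℕ, Writes e X p q ∧ IsPointName q (f z)

/-- A real-valued function as a function into the extended plane. -/
def realFun (u : Sphere → ℝ) (z : Sphere) : Sphere := (((u z : ℝ) : ℂ) : Sphere)

/-- The pair of an oracle and a machine as a sequence on a tape: the code number of the machine,
followed by the characteristic sequence of the oracle. -/
def functionTape (X : Set ℕ) (e : Nat.Partrec.Code) : ℕ → ℕ
  | 0 => Encodable.encode e
  | n + 1 => bit X n

/-- Three sequences on one tape, interleaved. -/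
def triple (a b c : ℕ → ℕ) (n : ℕ) : ℕ :=
  if n % 3 = 0 then a (n / 3) else if n % 3 = 1 then b (n / 3) else c (n / 3)

/-! ### Harmonic functions on domains of the extended plane, harmonic conjugates -/

/-- `z ↦ 1 / z` from the plane to the extended plane, with `1 / 0 = ∞`. -/
def invPt (z : ℂ) : Sphere :=
  open Classical in if z = 0 then OnePoint.infty else ((z⁻¹ : ℂ) : Sphere)

/-- `u` is a harmonic function with domain `D`, an open connected subset of the extended plane. -/
structure IsHarmonicOn (u : Sphere → ℝ) (D : Set Sphere) : Prop where
  isOpen : IsOpen D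
  isConnected : IsConnected D
  finite : HarmonicOnNhd (fun z : ℂ => u (z : Sphere)) {z : ℂ | (z : Sphere) ∈ D}
  infty : OnePoint.infty ∈ D →
    ∃ ρ : ℝ, 0 < ρ ∧ HarmonicOnNhd (fun z : ℂ => u (invPt z)) (Metric.ball 0 ρ)

/-- `v` is a harmonic conjugate of `u` on the subset `s` of the plane: both are harmonic and
satisfy the Cauchy-Riemann equations `u_x = v_y`, `u_y = - v_x`. -/
structure IsHarmonicConjugateOn (u v : ℂ → ℝ) (s : Set ℂ) : Prop where
  left : HarmonicOnNhd u s
  right : HarmonicOnNhd v s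
  cr₁ : ∀ z ∈ s, fderiv ℝ u z 1 = fderiv ℝ v z I
  cr₂ : ∀ z ∈ s, fderiv ℝ u z I = -fderiv ℝ v z 1

/-- The conjugate Poisson integral of `u` over the circle of radius `r` about `z₀`:
`(1 / 2πi) ∫₀^{2π} u(z₀ + r e^{iθ}) (r e^{-iθ} w - r e^{iθ} w̄) / |r e^{iθ} - w|² dθ`, where
`w = z - z₀`. -/
def conjugatePoisson (u : ℂ → ℝ) (z₀ : ℂ) (r : ℝ) (z : ℂ) : ℂ :=
  (1 / (2 * (Real.pi : ℂ) * I)) *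
    ∫ θ in (0 : ℝ)..(2 * Real.pi),
      (u (z₀ + r * exp (I * θ)) : ℂ) *
        ((r * exp (-(I * θ)) * (z - z₀) - r * exp (I * θ) * (starRingEnd ℂ) (z - z₀)) /
          ((‖r * exp (I * θ) - (z - z₀)‖ : ℝ) : ℂ) ^ 2)

end

end ComputableConjugation

open ComputableConjugation

/-!
On the disk, `u` is the real part of a holomorphic function `F`, and `Im F - Im F z₀` is the
harmonic conjugate that vanishes at `z₀`; the Herglotz-Riesz representation of `F` on a circle of
radius `r` gives the integral formula.

Membership of the values of the conjugate in basic sets has finite certificates. If a polynomial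
`P` with Gaussian rational coefficients satisfies `|u - Re P| ≤ ε` on the disk of radius `ρ < R`
about `z₀`, then by the Borel-Carathéodory theorem `Im P z - Im P z₀` differs from the conjugate at
`z` by at most `4 ε |z - z₀| / (ρ - |z - z₀|)`. The approximation can be confirmed from finitely
many bits of the oracle in the name of `u`: run on rectangles around the points of a fine grid, the
machine in that name lists rectangles that contain the values of `u` on a cover of the disk. Taylor
polynomials of `F` show that such a `P` exists for every `ε`, so a search through all certificates
lists all basic sets that contain the value of the conjugate, and no others.

The machine that performs this search is the same for all data, which it reads from its oracle, the
graph of the input tape. Hence a machine that copies its input tape already writes a name of the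
conjugate.
-/

namespace ComputableConjugation

/-! ### Primitive recursive functions and predicates -/

section Primitive

variable {α β : Type*} [Primcodable α] [Primcodable β]

theorem primrec_add {f g : α → ℕ} (hf : Primrec f) (hg : Primrec g) :
    Primrec fun a => f a + g a := Primrec.nat_add.comp hf hg

theorem primrec_mul {f g : α → ℕ} (hf : Primrec f) (hg : Primrec g) :
    Primrec fun a => f a * g a := Primrec.nat_mul.comp hf hg

theorem primrec_sub {f g : α → ℕ} (hf : Primrec f) (hg : Primrec g) :
    Primrec fun a => f a - g a := Primrec.nat_sub.comp hf hg

theorem primrec_div {f g : α → ℕ} (hf : Primrec f) (hg : Primrec g) :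
    Primrec fun a => f a / g a := Primrec.nat_div.comp hf hg

theorem primrec_mod {f g : α → ℕ} (hf : Primrec f) (hg : Primrec g) :
    Primrec fun a => f a % g a := Primrec.nat_mod.comp hf hg

theorem primrec_unpair {f : α → ℕ} (hf : Primrec f) : Primrec fun a => (f a).unpair :=
  Primrec.unpair.comp hf

theorem primrec_natPair {f g : α → ℕ} (hf : Primrec f) (hg : Primrec g) :
    Primrec fun a => Nat.pair (f a) (g a) := Primrec₂.natPair.comp hf hg

theorem primrec_encode {f : α → β} (hf : Primrec f) :
    Primrec fun a => Encodable.encode (f a) := Primrec.encode.comp hf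

theorem primrec_ofNat {δ : Type*} [Denumerable δ] {f : α → ℕ} (hf : Primrec f) :
    Primrec fun a => Denumerable.ofNat δ (f a) := (Primrec.ofNat δ).comp hf

theorem primrec_length {f : α → List β} (hf : Primrec f) :
    Primrec fun a => (f a).length := Primrec.list_length.comp hf

theorem primrec_append {f g : α → List β} (hf : Primrec f) (hg : Primrec g) :
    Primrec fun a => f a ++ g a := Primrec.list_append.comp hf hg

theorem primrec_cons {f : α → β} {g : α → List β} (hf : Primrec f) (hg : Primrec g) :
    Primrec fun a => f a :: g a := Primrec.list_cons.comp hf hg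

theorem primrec_getElem? {f : α → List β} {g : α → ℕ} (hf : Primrec f) (hg : Primrec g) :
    Primrec fun a => (f a)[g a]? := Primrec.list_getElem?.comp hf hg

theorem primrec_some {f : α → β} (hf : Primrec f) : Primrec fun a => some (f a) :=
  Primrec.option_some.comp hf

theorem primrec_evaln {f g : α → ℕ} {c : α → Nat.Partrec.Code} (hf : Primrec f) (hc : Primrec c)
    (hg : Primrec g) : Primrec fun a => Nat.Partrec.Code.evaln (f a) (c a) (g a) :=
  Nat.Partrec.Code.primrec_evaln.comp (Primrec.pair (Primrec.pair hf hc) hg)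

theorem primrec_option_map {γ : Type*} [Primcodable γ] {f : α → Option β} {g : α → β → γ}
    (hf : Primrec f) (hg : Primrec fun q : α × β => g q.1 q.2) :
    Primrec fun a => (f a).map (g a) := Primrec.option_map hf hg

theorem primrec_option_bind {γ : Type*} [Primcodable γ] {f : α → Option β} {g : α → β → Option γ}
    (hf : Primrec f) (hg : Primrec fun q : α × β => g q.1 q.2) :
    Primrec fun a => (f a).bind (g a) := Primrec.option_bind hf hg

theorem primrecPred_lt {f g : α → ℕ} (hf : Primrec f) (hg : Primrec g) :
    PrimrecPred fun a => f a < g a := Primrec.nat_lt.comp hf hg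

theorem primrecPred_eq {f g : α → β} (hf : Primrec f) (hg : Primrec g) :
    PrimrecPred fun a => f a = g a := Primrec.eq.comp hf hg

theorem primrecRel_swap {p : α → β → Prop} (hp : PrimrecPred fun q : α × β => p q.1 q.2) :
    PrimrecRel fun b a => p a b :=
  (hp.comp (Primrec.pair Primrec.snd Primrec.fst)).primrecRel

theorem primrecPred_forall_mem {f : α → List β} {p : α → β → Prop} (hf : Primrec f)
    (hp : PrimrecPred fun q : α × β => p q.1 q.2) : PrimrecPred fun a => ∀ b ∈ f a, p a b :=
  (primrecRel_swap hp).forall_mem_list.comp hf Primrec.id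

theorem primrecPred_exists_mem {f : α → List β} {p : α → β → Prop} (hf : Primrec f)
    (hp : PrimrecPred fun q : α × β => p q.1 q.2) : PrimrecPred fun a => ∃ b ∈ f a, p a b :=
  (primrecRel_swap hp).exists_mem_list.comp hf Primrec.id

theorem primrecPred_forall_lt {f : α → ℕ} {p : α → ℕ → Prop} (hf : Primrec f)
    (hp : PrimrecPred fun q : α × ℕ => p q.1 q.2) : PrimrecPred fun a => ∀ i < f a, p a i :=
  (primrecPred_forall_mem (Primrec.list_range.comp hf) hp).of_eq fun a => by
    simp only [List.mem_range]

theorem primrecPred_exists_lt {f : α → ℕ} {p : α → ℕ → Prop} (hf : Primrec f)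
    (hp : PrimrecPred fun q : α × ℕ => p q.1 q.2) : PrimrecPred fun a => ∃ i < f a, p a i :=
  (primrecPred_exists_mem (Primrec.list_range.comp hf) hp).of_eq fun a => by
    simp only [List.mem_range]

end Primitive

attribute [fun_prop] Primrec PrimrecPred
attribute [fun_prop] Primrec.id Primrec.const Primrec.comp Primrec.fst Primrec.snd Primrec.pair
  primrec_add primrec_mul primrec_sub primrec_div primrec_mod primrec_unpair primrec_natPair
  primrec_encode primrec_ofNat primrec_length primrec_append primrec_cons primrec_getElem?
  primrec_some primrec_evaln
attribute [fun_prop] PrimrecPred.and PrimrecPred.or PrimrecPred.not primrecPred_lt primrecPred_eq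

theorem ratOf_pair (a b d : ℕ) : ratOf (Nat.pair a (Nat.pair b d)) = ((a : ℚ) - b) / (d + 1) := by
  simp only [ratOf, Nat.unpair_pair]

theorem exists_ratOf_eq (q : ℚ) : ∃ k, ratOf k = q := by
  refine ⟨Nat.pair q.num.toNat (Nat.pair (-q.num).toNat (q.den - 1)), ?_⟩
  have hnum : (q.num.toNat : ℚ) - ((-q.num).toNat : ℚ) = q.num := by
    exact_mod_cast Int.toNat_sub_toNat_neg q.num
  have hden : ((q.den - 1 : ℕ) : ℚ) + 1 = q.den := by
    exact_mod_cast Nat.sub_add_cancel q.den_pos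
  rw [ratOf_pair, hnum, hden, Rat.num_div_den]

/-- A rational-valued function is primitive recursive if it is a quotient `(a - b) / d` of
primitive recursive functions `a`, `b`, `d` with natural values, where `d` is positive. -/
@[fun_prop]
def RatPrimrec {α : Type*} [Primcodable α] (g : α → ℚ) : Prop :=
  ∃ a b d : α → ℕ, Primrec a ∧ Primrec b ∧ Primrec d ∧
    ∀ x, 0 < d x ∧ g x = ((a x : ℚ) - b x) / d x

namespace RatPrimrec

variable {α β : Type*} [Primcodable α] [Primcodable β] {f g : α → ℚ}

theorem exists_ratOf_eq (hg : RatPrimrec g) : ∃ c : α → ℕ, Primrec c ∧ ∀ x, ratOf (c x) = g x := by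
  obtain ⟨a, b, d, ha, hb, hd, h⟩ := hg
  refine ⟨fun x => Nat.pair (a x) (Nat.pair (b x) (d x - 1)), by fun_prop, fun x => ?_⟩
  have hden : ((d x - 1 : ℕ) : ℚ) + 1 = d x := by exact_mod_cast Nat.sub_add_cancel (h x).1
  rw [ratOf_pair, hden, (h x).2]

theorem ratOf {c : α → ℕ} (hc : Primrec c) : RatPrimrec fun x => ratOf (c x) :=
  ⟨fun x => (c x).unpair.1, fun x => (c x).unpair.2.unpair.1, fun x => (c x).unpair.2.unpair.2 + 1,
    by fun_prop, by fun_prop, by fun_prop, fun x => ⟨Nat.succ_pos _, by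
      simp only [ComputableConjugation.ratOf, Nat.cast_add, Nat.cast_one]⟩⟩

theorem posRatOf {c : α → ℕ} (hc : Primrec c) : RatPrimrec fun x => posRatOf (c x) :=
  ⟨fun x => (c x).unpair.1 + 1, fun _ => 0, fun x => (c x).unpair.2 + 1,
    by fun_prop, by fun_prop, by fun_prop, fun x => ⟨Nat.succ_pos _, by
      simp only [ComputableConjugation.posRatOf, Nat.cast_add, Nat.cast_one, Nat.cast_zero,
        sub_zero]⟩⟩

theorem natCast {c : α → ℕ} (hc : Primrec c) : RatPrimrec fun x => (c x : ℚ) :=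
  ⟨c, fun _ => 0, fun _ => 1, hc, by fun_prop, by fun_prop, fun x => ⟨one_pos, by simp⟩⟩

theorem const (q : ℚ) : RatPrimrec fun _ : α => q := by
  obtain ⟨k, rfl⟩ := ComputableConjugation.exists_ratOf_eq q
  exact ratOf (Primrec.const k)

theorem comp {f : β → ℚ} {h : α → β} (hf : RatPrimrec f) (hh : Primrec h) :
    RatPrimrec fun x => f (h x) := by
  obtain ⟨a, b, d, ha, hb, hd, H⟩ := hf
  exact ⟨_, _, _, ha.comp hh, hb.comp hh, hd.comp hh, fun x => H (h x)⟩

theorem neg (hf : RatPrimrec f) : RatPrimrec fun x => -f x := by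
  obtain ⟨a, b, d, ha, hb, hd, h⟩ := hf
  refine ⟨b, a, d, hb, ha, hd, fun x => ⟨(h x).1, ?_⟩⟩
  beta_reduce
  rw [(h x).2, ← neg_div, neg_sub]

theorem add (hf : RatPrimrec f) (hg : RatPrimrec g) : RatPrimrec fun x => f x + g x := by
  obtain ⟨a, b, d, ha, hb, hd, h⟩ := hf
  obtain ⟨a', b', d', ha', hb', hd', h'⟩ := hg
  refine ⟨fun x => a x * d' x + d x * a' x, fun x => b x * d' x + d x * b' x,
    fun x => d x * d' x, by fun_prop, by fun_prop, by fun_prop,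
    fun x => ⟨Nat.mul_pos (h x).1 (h' x).1, ?_⟩⟩
  beta_reduce
  rw [(h x).2, (h' x).2, div_add_div _ _ (by exact_mod_cast (h x).1.ne')
    (by exact_mod_cast (h' x).1.ne')]
  push_cast
  ring

theorem sub (hf : RatPrimrec f) (hg : RatPrimrec g) : RatPrimrec fun x => f x - g x := by
  simp only [sub_eq_add_neg]
  exact hf.add hg.neg

theorem mul (hf : RatPrimrec f) (hg : RatPrimrec g) : RatPrimrec fun x => f x * g x := by
  obtain ⟨a, b, d, ha, hb, hd, h⟩ := hf
  obtain ⟨a', b', d', ha', hb', hd', h'⟩ := hg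
  refine ⟨fun x => a x * a' x + b x * b' x, fun x => a x * b' x + b x * a' x,
    fun x => d x * d' x, by fun_prop, by fun_prop, by fun_prop,
    fun x => ⟨Nat.mul_pos (h x).1 (h' x).1, ?_⟩⟩
  beta_reduce
  rw [(h x).2, (h' x).2, div_mul_div_comm]
  push_cast
  ring

theorem sq (hf : RatPrimrec f) : RatPrimrec fun x => f x ^ 2 := by
  simp only [pow_two]
  exact hf.mul hf

theorem abs (hf : RatPrimrec f) : RatPrimrec fun x => |f x| := by
  obtain ⟨a, b, d, ha, hb, hd, h⟩ := hf
  refine ⟨fun x => (a x - b x) + (b x - a x), fun _ => 0, d, by fun_prop, by fun_prop, hd,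
    fun x => ⟨(h x).1, ?_⟩⟩
  have habs : ((a x - b x + (b x - a x) : ℕ) : ℚ) = |(a x : ℚ) - b x| := by
    rcases le_total (a x) (b x) with hle | hle
    · rw [Nat.sub_eq_zero_of_le hle, Nat.zero_add, abs_sub_comm, Nat.cast_sub hle,
        abs_of_nonneg (sub_nonneg.2 (Nat.cast_le.2 hle))]
    · rw [Nat.sub_eq_zero_of_le hle, Nat.add_zero, Nat.cast_sub hle,
        abs_of_nonneg (sub_nonneg.2 (Nat.cast_le.2 hle))]
  beta_reduce
  rw [(h x).2, habs, abs_div, Nat.abs_cast, Nat.cast_zero, sub_zero]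

theorem lt (hf : RatPrimrec f) (hg : RatPrimrec g) : PrimrecPred fun x => f x < g x := by
  obtain ⟨a, b, d, ha, hb, hd, h⟩ := hf
  obtain ⟨a', b', d', ha', hb', hd', h'⟩ := hg
  have hlt : PrimrecPred fun x => a x * d' x + b' x * d x < a' x * d x + b x * d' x := by fun_prop
  refine hlt.of_eq fun x => ?_
  rw [(h x).2, (h' x).2, div_lt_div_iff₀ (by exact_mod_cast (h x).1)
    (by exact_mod_cast (h' x).1), ← Nat.cast_lt (α := ℚ)]
  push_cast
  constructor <;> intro h <;> linarith

theorem le (hf : RatPrimrec f) (hg : RatPrimrec g) : PrimrecPred fun x => f x ≤ g x :=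
  (hg.lt hf).not.of_eq fun _ => not_lt

end RatPrimrec

attribute [fun_prop] RatPrimrec.ratOf RatPrimrec.natCast RatPrimrec.const RatPrimrec.comp
  RatPrimrec.neg RatPrimrec.add RatPrimrec.mul RatPrimrec.sub RatPrimrec.sq RatPrimrec.abs
  RatPrimrec.posRatOf RatPrimrec.lt RatPrimrec.le

/-! ### Runs of machines -/

section Runs

variable {e : Nat.Partrec.Code} {X : Set ℕ} {p : ℕ → ℕ}

theorem mem_run_succ {t : ℕ} {C : Config} :
    C ∈ run e X p (t + 1) ↔
      ∃ B ∈ run e X p t, ∃ k ∈ e.eval (Nat.pair B.state B.reply), act X p B k = C := by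
  simp only [run, step, Part.mem_bind_iff, Part.mem_map_iff]

theorem output_prefix_output_act (C : Config) (k : ℕ) : C.output <+: (act X p C k).output := by
  unfold act
  split
  · exact List.prefix_rfl
  · exact List.prefix_rfl
  · exact List.prefix_append _ _

theorem output_prefix_of_mem_run {t s : ℕ} {B C : Config} (hts : t ≤ s) (hB : B ∈ run e X p t)
    (hC : C ∈ run e X p s) : B.output <+: C.output := by
  induction s, hts using Nat.le_induction generalizing C with
  | base => rw [Part.mem_unique hB hC]
  | succ s _ ih =>
    obtain ⟨A, hA, k, -, rfl⟩ := mem_run_succ.1 hC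
    exact (ih hA).trans (output_prefix_output_act A k)

theorem getElem?_output_unique {t s n x y : ℕ} {B C : Config} (hB : B ∈ run e X p t)
    (hC : C ∈ run e X p s) (hx : B.output[n]? = some x) (hy : C.output[n]? = some y) : x = y := by
  wlog hts : t ≤ s generalizing t s x y B C
  · exact (this hC hB hy hx (Nat.le_of_not_le hts)).symm
  obtain ⟨l, hl⟩ := output_prefix_of_mem_run hts hB hC
  rw [← hl, List.getElem?_append_left (List.getElem?_eq_some_iff.1 hx).1, hx] at hy
  exact Option.some_injective _ hy

theorem Writes.exists_eq_iff {q : ℕ → ℕ} (h : Writes e X p q) (x : ℕ) :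
    (∃ n, q n = x) ↔ ∃ t, ∃ C ∈ run e X p t, x ∈ C.output := by
  constructor
  · rintro ⟨n, rfl⟩
    obtain ⟨t, C, hC, hn⟩ := h n
    exact ⟨t, C, hC, List.mem_of_getElem? hn⟩
  · rintro ⟨t, C, hC, hx⟩
    obtain ⟨n, hn⟩ := List.getElem?_of_mem hx
    obtain ⟨s, B, hB, hq⟩ := h n
    exact ⟨n, getElem?_output_unique hB hC hq hn⟩

theorem exists_writes_of_infinite {S : Set ℕ} (hS : S.Infinite)
    (h : ∀ k ∈ S, ∃ t, ∃ C ∈ run e X p t, k ∈ C.output) : ∃ q, Writes e X p q := by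
  have long_output : ∀ n, ∃ t, ∃ C ∈ run e X p t, n < C.output.length := by
    intro n
    obtain ⟨A, hAS, hcard⟩ := hS.exists_subset_card_eq (n + 1)
    have : Nonempty Config := ⟨Config.init⟩
    choose! t C hC hmem using h
    obtain ⟨k, hkA, hmax⟩ := A.exists_max_image t (Finset.card_pos.1 (by omega))
    have hsub : A ⊆ (C k).output.toFinset := fun j hj => List.mem_toFinset.2 <|
      (output_prefix_of_mem_run (hmax j hj) (hC j (hAS hj)) (hC k (hAS hkA))).subset
        (hmem j (hAS hj))
    refine ⟨t k, C k, hC k (hAS hkA), ?_⟩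
    calc n < A.card := by omega
      _ ≤ (C k).output.toFinset.card := Finset.card_le_card hsub
      _ ≤ (C k).output.length := List.toFinset_card_le _
  choose t C hC hlt using long_output
  exact ⟨fun n => (C n).output[n]'(hlt n), fun n => ⟨t n, C n, hC n,
    List.getElem?_eq_getElem (hlt n)⟩⟩

theorem act_read (C : Config) (s x : ℕ) :
    act X p C (Nat.pair s (Nat.pair 0 x)) = ⟨s, p C.head, C.head + 1, C.output⟩ := by
  simp only [act, Nat.unpair_pair]

theorem act_ask (C : Config) (s x : ℕ) :
    act X p C (Nat.pair s (Nat.pair 1 x)) = ⟨s, bit X x, C.head, C.output⟩ := by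
  simp only [act, Nat.unpair_pair]

theorem act_write (C : Config) (s x : ℕ) :
    act X p C (Nat.pair s (Nat.pair 2 x)) = ⟨s, 0, C.head, C.output ++ [x]⟩ := by
  simp only [act, Nat.unpair_pair]

end Runs

/-! ### Machines that follow a strategy -/

/-- The program of a machine that follows the strategy `F`: the list of all replies so far is
mapped by `F` to the type and the argument of the next action. The internal state is the list of
replies without the last one. -/
def strategyProgram (F : List ℕ → ℕ × ℕ) (n : ℕ) : ℕ :=
  let H := Denumerable.ofNat (List ℕ) n.unpair.1 ++ [n.unpair.2]
  Nat.pair (Encodable.encode H) (Nat.pair (F H).1 (F H).2)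

theorem exists_code_eval_strategyProgram {F : List ℕ → ℕ × ℕ} (hF : Primrec F) :
    ∃ e : Nat.Partrec.Code, ∀ n, e.eval n = Part.some (strategyProgram F n) := by
  have h : Primrec (strategyProgram F) := by
    unfold strategyProgram
    fun_prop
  obtain ⟨e, he⟩ := Nat.Partrec.Code.exists_code.1 (Nat.Partrec.of_primrec (Primrec.nat_iff.1 h))
  exact ⟨e, fun n => by rw [he]; rfl⟩

/-- The configuration after `t` steps of a machine that follows the strategy `F`. -/
noncomputable def strategyRun (F : List ℕ → ℕ × ℕ) (X : Set ℕ) (p : ℕ → ℕ) : ℕ → Config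
  | 0 => Config.init
  | t + 1 => act X p (strategyRun F X p t) (strategyProgram F
      (Nat.pair (strategyRun F X p t).state (strategyRun F X p t).reply))

/-- The first `t` replies to a machine that follows the strategy `F`, beginning with the reply of
the initial configuration. -/
noncomputable def replies (F : List ℕ → ℕ × ℕ) (X : Set ℕ) (p : ℕ → ℕ) (t : ℕ) : List ℕ :=
  (List.range t).map fun i => (strategyRun F X p i).reply

section Strategy

variable {F : List ℕ → ℕ × ℕ} {e : Nat.Partrec.Code} {X : Set ℕ} {p : ℕ → ℕ}

theorem run_eq_strategyRun (he : ∀ n, e.eval n = Part.some (strategyProgram F n)) (t : ℕ) :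
    run e X p t = Part.some (strategyRun F X p t) := by
  induction t with
  | zero => rfl
  | succ t ih => rw [run, ih, Part.bind_some, step, he, Part.map_some, strategyRun]

theorem length_replies (t : ℕ) : (replies F X p t).length = t := by
  rw [replies, List.length_map, List.length_range]

theorem replies_succ (t : ℕ) :
    replies F X p (t + 1) = replies F X p t ++ [(strategyRun F X p t).reply] := by
  rw [replies, List.range_succ, List.map_append]
  rfl

theorem getElem?_replies {i t : ℕ} (h : i < t) :
    (replies F X p t)[i]? = some (strategyRun F X p i).reply := by
  rw [replies, List.getElem?_map, List.getElem?_range h, Option.map_some]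

theorem state_act (C : Config) (k : ℕ) : (act X p C k).state = k.unpair.1 := by
  unfold act
  split <;> rfl

theorem state_strategyRun (t : ℕ) :
    (strategyRun F X p t).state = Encodable.encode (replies F X p t) := by
  induction t with
  | zero => rfl
  | succ t ih =>
    rw [strategyRun, state_act, strategyProgram, replies_succ, ih]
    simp only [Nat.unpair_pair, Denumerable.ofNat_encode]

theorem strategyRun_succ (t : ℕ) :
    strategyRun F X p (t + 1) = act X p (strategyRun F X p t)
      (Nat.pair (Encodable.encode (replies F X p (t + 1)))
        (Nat.pair (F (replies F X p (t + 1))).1 (F (replies F X p (t + 1))).2)) := by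
  rw [strategyRun, strategyProgram, state_strategyRun, replies_succ]
  simp only [Nat.unpair_pair, Denumerable.ofNat_encode]

theorem strategyRun_read {t x : ℕ} (h : F (replies F X p (t + 1)) = (0, x)) :
    strategyRun F X p (t + 1) = ⟨Encodable.encode (replies F X p (t + 1)),
      p (strategyRun F X p t).head, (strategyRun F X p t).head + 1,
      (strategyRun F X p t).output⟩ := by
  rw [strategyRun_succ, h, act_read]

theorem strategyRun_ask {t x : ℕ} (h : F (replies F X p (t + 1)) = (1, x)) :
    strategyRun F X p (t + 1) = ⟨Encodable.encode (replies F X p (t + 1)), bit X x,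
      (strategyRun F X p t).head, (strategyRun F X p t).output⟩ := by
  rw [strategyRun_succ, h, act_ask]

theorem strategyRun_write {t x : ℕ} (h : F (replies F X p (t + 1)) = (2, x)) :
    strategyRun F X p (t + 1) = ⟨Encodable.encode (replies F X p (t + 1)), 0,
      (strategyRun F X p t).head, (strategyRun F X p t).output ++ [x]⟩ := by
  rw [strategyRun_succ, h, act_write]

end Strategy

/-! ### Copying the input tape into an oracle -/

/-- The graph of a sequence, as a set of natural numbers. -/
def graphSet (T : ℕ → ℕ) : Set ℕ := {y | T y.unpair.1 = y.unpair.2}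

theorem pair_mem_graphSet {T : ℕ → ℕ} {n x : ℕ} : Nat.pair n x ∈ graphSet T ↔ T n = x := by
  rw [graphSet, Set.mem_ofPred_eq, Nat.unpair_pair]

/-- The symbol that the strategy `copyStrategy` writes next: first the number `c`, and then the
characteristic sequence of the graph of the tape. Cell `i` of the tape is the reply with index
`2 * i + 1`; it is known when the symbol for `⟨i, x⟩` is due, because `i ≤ ⟨i, x⟩`. -/
def copySymbol (c : ℕ) (H : List ℕ) : ℕ :=
  if H.length = 2 then c
  else if H[2 * (H.length / 2 - 2).unpair.1 + 1]? = some (H.length / 2 - 2).unpair.2 then 1 else 0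

/-- The strategy that reads and writes in turns, and thereby turns a tape into the name that
consists of the machine with code number `c` and of the graph of the tape. -/
def copyStrategy (c : ℕ) (H : List ℕ) : ℕ × ℕ :=
  if H.length % 2 = 1 then (0, 0) else (2, copySymbol c H)

theorem primrec_copyStrategy (c : ℕ) : Primrec (copyStrategy c) := by
  have hsymbol : Primrec (copySymbol c) := by
    unfold copySymbol
    exact Primrec.ite (by fun_prop) (by fun_prop)
      (Primrec.ite (by fun_prop) (by fun_prop) (by fun_prop))
  unfold copyStrategy
  exact Primrec.ite (by fun_prop) (by fun_prop) (by fun_prop)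

section Copy

variable {c : ℕ} {X : Set ℕ} {T : ℕ → ℕ}

theorem copyStrategy_replies_odd (j : ℕ) :
    copyStrategy c (replies (copyStrategy c) X T (2 * j + 1)) = (0, 0) := by
  rw [copyStrategy, length_replies, if_pos (by omega)]

theorem copyStrategy_replies_even (j : ℕ) :
    copyStrategy c (replies (copyStrategy c) X T (2 * j + 1 + 1)) =
      (2, copySymbol c (replies (copyStrategy c) X T (2 * j + 2))) := by
  rw [copyStrategy, length_replies, if_neg (by omega)]

theorem head_strategyRun_copyStrategy (j : ℕ) :
    (strategyRun (copyStrategy c) X T (2 * j)).head = j := by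
  induction j with
  | zero => rfl
  | succ j ih =>
    rw [Nat.mul_succ, strategyRun_write (copyStrategy_replies_even j),
      strategyRun_read (copyStrategy_replies_odd j), ih]

theorem reply_strategyRun_copyStrategy (j : ℕ) :
    (strategyRun (copyStrategy c) X T (2 * j + 1)).reply = T j := by
  rw [strategyRun_read (copyStrategy_replies_odd j), head_strategyRun_copyStrategy]

theorem copySymbol_replies (e : Nat.Partrec.Code) (j : ℕ) :
    copySymbol (Encodable.encode e) (replies (copyStrategy c) X T (2 * j + 2)) =
      functionTape (graphSet T) e j := by
  rw [copySymbol, length_replies]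
  cases j with
  | zero => rfl
  | succ j =>
    have hread : 2 * j.unpair.1 + 1 < 2 * (j + 1) + 2 := by
      have := Nat.unpair_left_le j
      omega
    rw [if_neg (by omega), show (2 * (j + 1) + 2) / 2 - 2 = j by omega, getElem?_replies hread,
      reply_strategyRun_copyStrategy, functionTape, bit, graphSet, Set.mem_ofPred_eq]
    simp only [Option.some.injEq]
    congr

theorem output_strategyRun_copyStrategy (e : Nat.Partrec.Code) (j : ℕ) :
    (strategyRun (copyStrategy (Encodable.encode e)) X T (2 * j)).output =
      (List.range j).map (functionTape (graphSet T) e) := by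
  induction j with
  | zero => rfl
  | succ j ih =>
    rw [Nat.mul_succ, strategyRun_write (copyStrategy_replies_even j),
      strategyRun_read (copyStrategy_replies_odd j), ih, copySymbol_replies, List.range_succ,
      List.map_append]
    rfl

end Copy

theorem exists_copy_machine (e : Nat.Partrec.Code) :
    ∃ M : Nat.Partrec.Code, ∀ X T, Writes M X T (functionTape (graphSet T) e) := by
  obtain ⟨M, hM⟩ := exists_code_eval_strategyProgram (primrec_copyStrategy (Encodable.encode e))
  refine ⟨M, fun X T n => ⟨2 * (n + 1), strategyRun (copyStrategy (Encodable.encode e)) X T _,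
    by rw [run_eq_strategyRun hM]; exact Part.mem_some _, ?_⟩⟩
  rw [output_strategyRun_copyStrategy, List.getElem?_map, List.getElem?_range n.lt_succ_self,
    Option.map_some]

/-! ### Enumeration of a set by certificates -/

/-- The partial function `o` is a restriction of `f`. -/
def IsFragment (o : ℕ → Option ℕ) (f : ℕ → ℕ) : Prop := ∀ x y, o x = some y → f x = y

/-- The partial function `o` is defined and agrees with `f` up to `b`. -/
def CoversUpTo (o : ℕ → Option ℕ) (f : ℕ → ℕ) (b : ℕ) : Prop := ∀ x ≤ b, o x = some (f x)

theorem CoversUpTo.mono {o : ℕ → Option ℕ} {f : ℕ → ℕ} {a b : ℕ} (h : CoversUpTo o f b)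
    (hab : a ≤ b) : CoversUpTo o f a := fun x hx => h x (hx.trans hab)

/-- What the list `H` of replies to a machine that follows `searchStrategy` tells about the input
tape. -/
def inputReply (H : List ℕ) (n : ℕ) : Option ℕ := H[3 * n + 1]?

/-- What the list `H` of replies to a machine that follows `searchStrategy` tells about the
oracle. -/
def oracleReply (H : List ℕ) (y : ℕ) : Option ℕ := H[3 * y + 2]?

/-- The strategy that in round `s` reads cell `s` of the input tape, asks the oracle about `s`, and
writes the first component of `s` if `s` is a certificate for it, given the replies so far; if it
is not, a question to the oracle fills the gap. -/
noncomputable def searchStrategy (G : List ℕ × ℕ → Prop) (H : List ℕ) : ℕ × ℕ :=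
  open Classical in
  if H.length % 3 = 1 then (0, 0)
  else if H.length % 3 = 2 then (1, H.length / 3)
  else if G (H, H.length / 3 - 1) then (2, (H.length / 3 - 1).unpair.1)
  else (1, 0)

theorem primrec_searchStrategy {G : List ℕ × ℕ → Prop} (hG : PrimrecPred G) :
    Primrec (searchStrategy G) := by
  classical
  unfold searchStrategy
  exact Primrec.ite (by fun_prop) (by fun_prop) (Primrec.ite (by fun_prop) (by fun_prop)
    (Primrec.ite (hG.comp (by fun_prop)) (by fun_prop) (by fun_prop)))

section Search

variable {G : List ℕ × ℕ → Prop} {Y : Set ℕ} {p : ℕ → ℕ} {s : ℕ}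

theorem strategyRun_searchStrategy_read (G : List ℕ × ℕ → Prop) (Y : Set ℕ) (p : ℕ → ℕ) (s : ℕ) :
    strategyRun (searchStrategy G) Y p (3 * s + 1) =
      ⟨Encodable.encode (replies (searchStrategy G) Y p (3 * s + 1)),
        p (strategyRun (searchStrategy G) Y p (3 * s)).head,
        (strategyRun (searchStrategy G) Y p (3 * s)).head + 1,
        (strategyRun (searchStrategy G) Y p (3 * s)).output⟩ := by
  refine strategyRun_read (x := 0) ?_
  rw [searchStrategy, length_replies, if_pos (by omega)]

theorem strategyRun_searchStrategy_ask (G : List ℕ × ℕ → Prop) (Y : Set ℕ) (p : ℕ → ℕ) (s : ℕ) :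
    strategyRun (searchStrategy G) Y p (3 * s + 2) =
      ⟨Encodable.encode (replies (searchStrategy G) Y p (3 * s + 2)), bit Y s,
        (strategyRun (searchStrategy G) Y p (3 * s)).head + 1,
        (strategyRun (searchStrategy G) Y p (3 * s)).output⟩ := by
  rw [strategyRun_ask (t := 3 * s + 1) (x := s), strategyRun_searchStrategy_read]
  rw [searchStrategy, length_replies, if_neg (by omega), if_pos (by omega),
    show (3 * s + 1 + 1) / 3 = s by omega]

theorem strategyRun_searchStrategy_of_certified
    (h : G (replies (searchStrategy G) Y p (3 * (s + 1)), s)) :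
    strategyRun (searchStrategy G) Y p (3 * (s + 1)) =
      ⟨Encodable.encode (replies (searchStrategy G) Y p (3 * (s + 1))), 0,
        (strategyRun (searchStrategy G) Y p (3 * s)).head + 1,
        (strategyRun (searchStrategy G) Y p (3 * s)).output ++ [s.unpair.1]⟩ := by
  rw [Nat.mul_succ] at h ⊢
  rw [strategyRun_write (t := 3 * s + 2) (x := s.unpair.1), strategyRun_searchStrategy_ask]
  rw [searchStrategy, length_replies, if_neg (by omega), if_neg (by omega),
    show (3 * s + 2 + 1) / 3 - 1 = s by omega, if_pos h]

theorem strategyRun_searchStrategy_of_not_certified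
    (h : ¬G (replies (searchStrategy G) Y p (3 * (s + 1)), s)) :
    strategyRun (searchStrategy G) Y p (3 * (s + 1)) =
      ⟨Encodable.encode (replies (searchStrategy G) Y p (3 * (s + 1))), bit Y 0,
        (strategyRun (searchStrategy G) Y p (3 * s)).head + 1,
        (strategyRun (searchStrategy G) Y p (3 * s)).output⟩ := by
  rw [Nat.mul_succ] at h ⊢
  rw [strategyRun_ask (t := 3 * s + 2) (x := 0), strategyRun_searchStrategy_ask]
  rw [searchStrategy, length_replies, if_neg (by omega), if_neg (by omega),
    show (3 * s + 2 + 1) / 3 - 1 = s by omega, if_neg h]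

theorem head_strategyRun_searchStrategy (G : List ℕ × ℕ → Prop) (Y : Set ℕ) (p : ℕ → ℕ) (s : ℕ) :
    (strategyRun (searchStrategy G) Y p (3 * s)).head = s := by
  induction s with
  | zero => rfl
  | succ s ih =>
    by_cases h : G (replies (searchStrategy G) Y p (3 * (s + 1)), s)
    · rw [strategyRun_searchStrategy_of_certified h, ih]
    · rw [strategyRun_searchStrategy_of_not_certified h, ih]

theorem reply_strategyRun_searchStrategy_read (n : ℕ) :
    (strategyRun (searchStrategy G) Y p (3 * n + 1)).reply = p n := by
  rw [strategyRun_searchStrategy_read, head_strategyRun_searchStrategy]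

theorem reply_strategyRun_searchStrategy_ask (y : ℕ) :
    (strategyRun (searchStrategy G) Y p (3 * y + 2)).reply = bit Y y := by
  rw [strategyRun_searchStrategy_ask]

theorem isFragment_inputReply (t : ℕ) :
    IsFragment (inputReply (replies (searchStrategy G) Y p t)) p := by
  intro n x hx
  have hlt : 3 * n + 1 < t := by
    simpa only [length_replies] using (List.getElem?_eq_some_iff.1 hx).1
  rw [inputReply, getElem?_replies hlt, reply_strategyRun_searchStrategy_read] at hx
  exact Option.some_injective _ hx

theorem isFragment_oracleReply (t : ℕ) :
    IsFragment (oracleReply (replies (searchStrategy G) Y p t)) (bit Y) := by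
  intro y x hx
  have hlt : 3 * y + 2 < t := by
    simpa only [length_replies] using (List.getElem?_eq_some_iff.1 hx).1
  rw [oracleReply, getElem?_replies hlt, reply_strategyRun_searchStrategy_ask] at hx
  exact Option.some_injective _ hx

theorem coversUpTo_inputReply (s : ℕ) :
    CoversUpTo (inputReply (replies (searchStrategy G) Y p (3 * (s + 1)))) p s := by
  intro n hn
  rw [inputReply, getElem?_replies (by omega), reply_strategyRun_searchStrategy_read]

theorem coversUpTo_oracleReply (s : ℕ) :
    CoversUpTo (oracleReply (replies (searchStrategy G) Y p (3 * (s + 1)))) (bit Y) s := by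
  intro y hy
  rw [oracleReply, getElem?_replies (by omega), reply_strategyRun_searchStrategy_ask]

theorem exists_certified_of_mem_output {k : ℕ}
    (hk : k ∈ (strategyRun (searchStrategy G) Y p (3 * s)).output) :
    ∃ t, G (replies (searchStrategy G) Y p (3 * (t + 1)), t) ∧ t.unpair.1 = k := by
  induction s with
  | zero => exact absurd hk List.not_mem_nil
  | succ s ih =>
    by_cases h : G (replies (searchStrategy G) Y p (3 * (s + 1)), s)
    · rw [strategyRun_searchStrategy_of_certified h, List.mem_append, List.mem_singleton] at hk
      exact hk.elim ih fun hk => ⟨s, h, hk.symm⟩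
    · rw [strategyRun_searchStrategy_of_not_certified h] at hk
      exact ih hk

theorem mem_output_of_certified (h : G (replies (searchStrategy G) Y p (3 * (s + 1)), s)) :
    s.unpair.1 ∈ (strategyRun (searchStrategy G) Y p (3 * (s + 1))).output := by
  rw [strategyRun_searchStrategy_of_certified h]
  exact List.mem_append_right _ (List.mem_singleton_self _)

end Search

theorem exists_search_machine {G : List ℕ × ℕ → Prop} (hG : PrimrecPred G) :
    ∃ e : Nat.Partrec.Code, ∀ (Y : Set ℕ) (p : ℕ → ℕ) (S : Set ℕ), S.Infinite →
      (∀ H s, IsFragment (oracleReply H) (bit Y) → IsFragment (inputReply H) p → G (H, s) →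
        s.unpair.1 ∈ S) →
      (∀ k ∈ S, ∃ s, s.unpair.1 = k ∧ ∀ H, CoversUpTo (oracleReply H) (bit Y) s →
        CoversUpTo (inputReply H) p s → G (H, s)) →
      ∃ q, Writes e Y p q ∧ ∀ k, (∃ i, q i = k) ↔ k ∈ S := by
  obtain ⟨e, he⟩ := exists_code_eval_strategyProgram (primrec_searchStrategy hG)
  refine ⟨e, fun Y p S hS hsound hcomplete => ?_⟩
  have hrun (t : ℕ) : strategyRun (searchStrategy G) Y p t ∈ run e Y p t := by
    rw [run_eq_strategyRun he]
    exact Part.mem_some _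
  have enumerates : ∀ k ∈ S, ∃ t, ∃ C ∈ run e Y p t, k ∈ C.output := by
    intro k hk
    obtain ⟨s, rfl, hs⟩ := hcomplete k hk
    exact ⟨_, _, hrun _, mem_output_of_certified
      (hs _ (coversUpTo_oracleReply s) (coversUpTo_inputReply s))⟩
  have enumerates_only : ∀ t, ∀ C ∈ run e Y p t, ∀ k ∈ C.output, k ∈ S := by
    intro t C hC k hk
    obtain ⟨s, hs, rfl⟩ := exists_certified_of_mem_output
      ((output_prefix_of_mem_run (Nat.le_mul_of_pos_left t three_pos) hC (hrun _)).subset hk)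
    exact hsound _ s (isFragment_oracleReply _) (isFragment_inputReply _) hs
  obtain ⟨q, hq⟩ := exists_writes_of_infinite hS enumerates
  refine ⟨q, hq, fun k => (hq.exists_eq_iff k).trans ⟨?_, enumerates k⟩⟩
  rintro ⟨t, C, hC, hk⟩
  exact enumerates_only t C hC k hk

/-! ### Simulation of a machine on finite information -/

/-- A configuration as a tuple, for the sake of its code number. -/
def configEquiv : Config ≃ ℕ × ℕ × ℕ × List ℕ where
  toFun C := (C.state, C.reply, C.head, C.output)
  invFun q := ⟨q.1, q.2.1, q.2.2.1, q.2.2.2⟩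

instance : Primcodable Config := Primcodable.ofEquiv _ configEquiv

/-- The effect of the value `k` of the program on a configuration, as `act`, for a partial oracle
`o` and a partial input `ι`; it is undefined if these do not contain the reply. -/
def simulateAct (o ι : ℕ → Option ℕ) (C : Config) (k : ℕ) : Option Config :=
  if k.unpair.2.unpair.1 = 0 then
    (ι C.head).map fun r => ⟨k.unpair.1, r, C.head + 1, C.output⟩
  else if k.unpair.2.unpair.1 = 1 then
    (o k.unpair.2.unpair.2).map fun r => ⟨k.unpair.1, r, C.head, C.output⟩
  else some ⟨k.unpair.1, 0, C.head, C.output ++ [k.unpair.2.unpair.2]⟩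

/-- One step of the machine `e` with a partial oracle `o` and a partial input `ι`, where the program
is evaluated with the bound `f` of `Nat.Partrec.Code.evaln`. -/
def simulateStep (o ι : ℕ → Option ℕ) (e : Nat.Partrec.Code) (f : ℕ) (C : Config) : Option Config :=
  (e.evaln f (Nat.pair C.state C.reply)).bind (simulateAct o ι C)

/-- The configuration after `t` steps as `simulateStep`. -/
def simulate (o ι : ℕ → Option ℕ) (e : Nat.Partrec.Code) (f : ℕ) : ℕ → Option Config
  | 0 => some Config.init
  | t + 1 => (simulate o ι e f t).bind (simulateStep o ι e f)

/-- What the simulated machine has written after `t` steps; nothing if the simulation breaks off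
before. -/
def simulatedOutput (o ι : ℕ → Option ℕ) (e : Nat.Partrec.Code) (f t : ℕ) : List ℕ :=
  ((simulate o ι e f t).map Config.output).getD []

section Simulation

variable {o ι : ℕ → Option ℕ} {e : Nat.Partrec.Code} {X : Set ℕ} {p : ℕ → ℕ}

theorem act_eq_of_simulateAct_eq_some (ho : IsFragment o (bit X)) (hι : IsFragment ι p)
    {C D : Config} {k : ℕ} (h : simulateAct o ι C k = some D) : act X p C k = D := by
  unfold simulateAct at h
  unfold act
  split <;> rename_i hk
  · rw [if_pos hk, Option.map_eq_some_iff] at h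
    obtain ⟨r, hr, rfl⟩ := h
    rw [hι _ _ hr]
  · rw [if_neg (by omega), if_pos hk, Option.map_eq_some_iff] at h
    obtain ⟨r, hr, rfl⟩ := h
    rw [ho _ _ hr]
  · rw [if_neg (by omega), if_neg (by omega)] at h
    exact Option.some_injective _ h

theorem simulateAct_eq_some_act {C : Config} {k b : ℕ} (ho : CoversUpTo o (bit X) b)
    (hι : CoversUpTo ι p b) (hC : C.head ≤ b) (hk : k.unpair.2.unpair.2 ≤ b) :
    simulateAct o ι C k = some (act X p C k) := by
  unfold simulateAct act
  rw [hι _ hC, ho _ hk, Option.map_some, Option.map_some]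
  split_ifs <;> split <;> first | rfl | grind

theorem mem_run_of_simulate_eq_some (ho : IsFragment o (bit X)) (hι : IsFragment ι p) {f t : ℕ}
    {C : Config} (hC : simulate o ι e f t = some C) : C ∈ run e X p t := by
  induction t generalizing C with
  | zero =>
    rw [simulate, Option.some_inj] at hC
    exact hC ▸ Part.mem_some _
  | succ t ih =>
    obtain ⟨B, hB, hC⟩ := Option.bind_eq_some_iff.1 hC
    obtain ⟨k, hk, hC⟩ := Option.bind_eq_some_iff.1 hC
    exact mem_run_succ.2 ⟨B, ih hB, k, Nat.Partrec.Code.evaln_sound hk,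
      act_eq_of_simulateAct_eq_some ho hι hC⟩

theorem exists_mem_run_of_mem_simulatedOutput (ho : IsFragment o (bit X)) (hι : IsFragment ι p)
    {f t x : ℕ} (hx : x ∈ simulatedOutput o ι e f t) : ∃ C ∈ run e X p t, x ∈ C.output := by
  rw [simulatedOutput] at hx
  rcases hC : simulate o ι e f t with _ | C
  · rw [hC] at hx
    exact absurd hx List.not_mem_nil
  · rw [hC] at hx
    exact ⟨C, mem_run_of_simulate_eq_some ho hι hC, hx⟩

theorem exists_forall_simulate_eq_some {t : ℕ} {C : Config} (hC : C ∈ run e X p t) :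
    ∃ b, ∀ o ι f, b ≤ f → CoversUpTo o (bit X) b → CoversUpTo ι p b →
      simulate o ι e f t = some C := by
  induction t generalizing C with
  | zero =>
    rw [run, Part.mem_some_iff] at hC
    exact ⟨0, fun _ _ _ _ _ _ => by rw [simulate, hC]⟩
  | succ t ih =>
    obtain ⟨B, hB, k, hk, rfl⟩ := mem_run_succ.1 hC
    obtain ⟨b, hb⟩ := ih hB
    obtain ⟨f₀, hf₀⟩ := Nat.Partrec.Code.evaln_complete.1 hk
    refine ⟨b + f₀ + B.head + k.unpair.2.unpair.2, fun o ι f hf ho hι => ?_⟩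
    have heval : e.evaln f (Nat.pair B.state B.reply) = some k :=
      Nat.Partrec.Code.evaln_mono (by omega) hf₀
    rw [simulate, hb o ι f (by omega) (ho.mono (by omega)) (hι.mono (by omega)), Option.bind_some,
      simulateStep, heval, Option.bind_some, simulateAct_eq_some_act ho hι (by omega) (by omega)]

theorem exists_forall_mem_simulatedOutput {t x : ℕ} {C : Config} (hC : C ∈ run e X p t)
    (hx : x ∈ C.output) : ∃ b, ∀ o ι f, b ≤ f → CoversUpTo o (bit X) b → CoversUpTo ι p b →
      x ∈ simulatedOutput o ι e f t := by
  obtain ⟨b, hb⟩ := exists_forall_simulate_eq_some hC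
  refine ⟨b, fun o ι f hf ho hι => ?_⟩
  rw [simulatedOutput, hb o ι f hf ho hι]
  exact hx

end Simulation

section PrimrecSimulation

variable {α β γ δ : Type*} [Primcodable α] [Primcodable β] [Primcodable γ] [Primcodable δ]

theorem primrec_comp_fst {g : α → γ → δ} {h : β → α} (hg : Primrec fun q : α × γ => g q.1 q.2)
    (hh : Primrec h) : Primrec fun q : β × γ => g (h q.1) q.2 :=
  hg.comp ((hh.comp Primrec.fst).pair Primrec.snd)

theorem primrec_state {C : α → Config} (hC : Primrec C) : Primrec fun a => (C a).state :=
  Primrec.fst.comp (Primrec.of_equiv.comp hC)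

theorem primrec_reply {C : α → Config} (hC : Primrec C) : Primrec fun a => (C a).reply :=
  (Primrec.fst.comp Primrec.snd).comp (Primrec.of_equiv.comp hC)

theorem primrec_head {C : α → Config} (hC : Primrec C) : Primrec fun a => (C a).head :=
  (Primrec.fst.comp (Primrec.snd.comp Primrec.snd)).comp (Primrec.of_equiv.comp hC)

theorem primrec_output {C : α → Config} (hC : Primrec C) : Primrec fun a => (C a).output :=
  (Primrec.snd.comp (Primrec.snd.comp Primrec.snd)).comp (Primrec.of_equiv.comp hC)

theorem primrec_config {s r h : α → ℕ} {l : α → List ℕ} (hs : Primrec s) (hr : Primrec r)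
    (hh : Primrec h) (hl : Primrec l) : Primrec fun a => (⟨s a, r a, h a, l a⟩ : Config) :=
  (Primrec.of_equiv_symm (e := configEquiv)).comp (hs.pair (hr.pair (hh.pair hl)))

attribute [fun_prop] primrec_state primrec_reply primrec_head primrec_output primrec_config

variable {o ι : α → ℕ → Option ℕ} {e : α → Nat.Partrec.Code} {f : α → ℕ}

theorem primrec_simulateAct {C : α → Config} {k : α → ℕ} (ho : Primrec fun q : α × ℕ => o q.1 q.2)
    (hι : Primrec fun q : α × ℕ => ι q.1 q.2) (hC : Primrec C) (hk : Primrec k) :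
    Primrec fun a => simulateAct (o a) (ι a) (C a) (k a) := by
  unfold simulateAct
  refine Primrec.ite (by fun_prop) ?_ (Primrec.ite (by fun_prop) ?_ (by fun_prop))
  · exact primrec_option_map (hι.comp (Primrec.id.pair (primrec_head hC))) (by fun_prop)
  · exact primrec_option_map (f := fun a => o a (k a).unpair.2.unpair.2)
      (ho.comp (Primrec.id.pair (by fun_prop))) (by fun_prop)

theorem primrec_simulateStep {C : α → Config} (ho : Primrec fun q : α × ℕ => o q.1 q.2)
    (hι : Primrec fun q : α × ℕ => ι q.1 q.2) (he : Primrec e) (hf : Primrec f) (hC : Primrec C) :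
    Primrec fun a => simulateStep (o a) (ι a) (e a) (f a) (C a) :=
  primrec_option_bind (by fun_prop) <| primrec_simulateAct (primrec_comp_fst ho Primrec.fst)
    (primrec_comp_fst hι Primrec.fst) (hC.comp Primrec.fst) Primrec.snd

theorem primrec_simulate {t : α → ℕ} (ho : Primrec fun q : α × ℕ => o q.1 q.2)
    (hι : Primrec fun q : α × ℕ => ι q.1 q.2) (he : Primrec e) (hf : Primrec f) (ht : Primrec t) :
    Primrec fun a => simulate (o a) (ι a) (e a) (f a) (t a) := by
  have hstep : Primrec fun q : α × ℕ × Option Config =>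
      q.2.2.bind (simulateStep (o q.1) (ι q.1) (e q.1) (f q.1)) := by
    refine primrec_option_bind (by fun_prop) ?_
    have hbase : Primrec fun q : (α × ℕ × Option Config) × Config => q.1.1 :=
      Primrec.fst.comp Primrec.fst
    exact primrec_simulateStep (primrec_comp_fst ho hbase) (primrec_comp_fst hι hbase)
      (he.comp hbase) (hf.comp hbase) Primrec.snd
  refine (Primrec.nat_rec' ht (Primrec.const (some Config.init)) hstep.to₂).of_eq fun a => ?_
  induction t a with
  | zero => rfl
  | succ n ih => exact congrArg (Option.bind · _) ih

theorem primrec_simulatedOutput {t : α → ℕ} (ho : Primrec fun q : α × ℕ => o q.1 q.2)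
    (hι : Primrec fun q : α × ℕ => ι q.1 q.2) (he : Primrec e) (hf : Primrec f) (ht : Primrec t) :
    Primrec fun a => simulatedOutput (o a) (ι a) (e a) (f a) (t a) :=
  Primrec.option_getD.comp (primrec_option_map (primrec_simulate ho hι he hf ht) (by fun_prop))
    (Primrec.const [])

end PrimrecSimulation

/-! ### Polynomials with Gaussian rational coefficients -/

section Polynomials

open Polynomial Metric

/-- The Gaussian rational number with code `a`. -/
noncomputable def gaussOf (a : ℕ × ℕ) : ℂ := ⟨(ratOf a.1 : ℝ), (ratOf a.2 : ℝ)⟩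

/-- The polynomial whose coefficients, in ascending order, have the codes in the list. -/
noncomputable def gaussPoly : List (ℕ × ℕ) → ℂ[X]
  | [] => 0
  | a :: P => C (gaussOf a) + X * gaussPoly P

theorem eval_gaussPoly_nil (w : ℂ) : (gaussPoly []).eval w = 0 := eval_zero

theorem eval_gaussPoly_cons (a : ℕ × ℕ) (P : List (ℕ × ℕ)) (w : ℂ) :
    (gaussPoly (a :: P)).eval w = gaussOf a + w * (gaussPoly P).eval w := by
  rw [gaussPoly, eval_add, eval_C, eval_mul, eval_X]

theorem exists_gaussOf_near (a : ℂ) {ε : ℝ} (hε : 0 < ε) : ∃ c, ‖a - gaussOf c‖ < ε := by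
  obtain ⟨x, hx⟩ := exists_rat_btwn (show a.re - ε / 2 < a.re by linarith)
  obtain ⟨y, hy⟩ := exists_rat_btwn (show a.im - ε / 2 < a.im by linarith)
  obtain ⟨i, rfl⟩ := exists_ratOf_eq x
  obtain ⟨j, rfl⟩ := exists_ratOf_eq y
  refine ⟨(i, j), (Complex.norm_le_abs_re_add_abs_im _).trans_lt ?_⟩
  simp only [gaussOf, sub_re, sub_im]
  rw [abs_of_pos (by linarith), abs_of_pos (by linarith)]
  linarith

theorem exists_gaussPoly_near (f : ℂ[X]) (B : ℝ) {ε : ℝ} (hε : 0 < ε) :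
    ∃ P, ∀ w : ℂ, ‖w‖ ≤ B → ‖f.eval w - (gaussPoly P).eval w‖ < ε := by
  induction hn : f.natDegree generalizing f ε with
  | zero =>
    obtain ⟨c, hc⟩ := exists_gaussOf_near (f.coeff 0) hε
    refine ⟨[c], fun w _ => ?_⟩
    rwa [eq_C_of_natDegree_eq_zero hn, eval_C, eval_gaussPoly_cons, eval_gaussPoly_nil, mul_zero,
      add_zero]
  | succ n ih =>
    have hB : 0 < |B| + 1 := by positivity
    obtain ⟨c, hc⟩ := exists_gaussOf_near (f.coeff 0) (half_pos hε)
    obtain ⟨P, hP⟩ := ih f.divX (ε := ε / 2 / (|B| + 1)) (by positivity)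
      (by rw [natDegree_divX_eq_natDegree_tsub_one, hn, Nat.add_sub_cancel])
    refine ⟨c :: P, fun w hw => ?_⟩
    have heval : f.eval w = f.coeff 0 + w * f.divX.eval w := by
      conv_lhs => rw [← divX_mul_X_add f]
      rw [eval_add, eval_mul, eval_X, eval_C, mul_comm, add_comm]
    rw [heval, eval_gaussPoly_cons, add_sub_add_comm, ← mul_sub]
    calc _ ≤ ‖f.coeff 0 - gaussOf c‖ + ‖w‖ * ‖f.divX.eval w - (gaussPoly P).eval w‖ :=
          (norm_add_le _ _).trans_eq (by rw [norm_mul])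
      _ < ε / 2 + (|B| + 1) * (ε / 2 / (|B| + 1)) :=
          add_lt_add_of_lt_of_le hc <| mul_le_mul (hw.trans ((le_abs_self B).trans (by linarith)))
            (hP w hw).le (norm_nonneg _) hB.le
      _ = ε := by rw [mul_div_cancel₀ _ hB.ne', add_halves]

theorem exists_polynomial_near_of_differentiableOn {F : ℂ → ℂ} {c : ℂ} {r R : ℝ} (hr : 0 < r)
    (hrR : r < R) (hF : DifferentiableOn ℂ F (ball c R)) {ε : ℝ} (hε : 0 < ε) :
    ∃ f : ℂ[X], ∀ w ∈ closedBall c r, ‖F w - f.eval w‖ < ε := by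
  obtain ⟨R₁, hrR₁, hR₁R⟩ := exists_between hrR
  obtain ⟨R₂, hrR₂, hR₂R₁⟩ := exists_between hrR₁
  lift R₁ to NNReal using (hr.trans hrR₁).le
  lift R₂ to NNReal using (hr.trans hrR₂).le
  have hseries := (hF.mono (closedBall_subset_ball hR₁R)).hasFPowerSeriesOnBall (hr.trans hrR₁)
  have hlim := hseries.tendstoUniformlyOn' (r' := R₂) (by exact_mod_cast hR₂R₁)
  obtain ⟨n, hn⟩ := (tendstoUniformlyOn_iff.1 hlim ε hε).exists
  refine ⟨∑ k ∈ Finset.range n, C ((cauchyPowerSeries F c R₁).coeff k) * (X - C c) ^ k,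
    fun w hw => ?_⟩
  have heval : (∑ k ∈ Finset.range n, C ((cauchyPowerSeries F c R₁).coeff k) * (X - C c) ^ k).eval w
      = (cauchyPowerSeries F c R₁).partialSum n (w - c) := by
    simp [eval_finsetSum, FormalMultilinearSeries.partialSum, mul_comm]
  rw [heval, ← dist_eq_norm]
  exact hn w (closedBall_subset_ball hrR₂ hw)

theorem exists_gaussPoly_near_of_differentiableOn {F : ℂ → ℂ} {c : ℂ} {r R : ℝ} (hr : 0 < r)
    (hrR : r < R) (hF : DifferentiableOn ℂ F (ball c R)) {ε : ℝ} (hε : 0 < ε) :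
    ∃ P, ∀ w ∈ closedBall c r, ‖F w - (gaussPoly P).eval w‖ < ε := by
  obtain ⟨f, hf⟩ := exists_polynomial_near_of_differentiableOn hr hrR hF (half_pos hε)
  obtain ⟨P, hP⟩ := exists_gaussPoly_near f (‖c‖ + r) (half_pos hε)
  refine ⟨P, fun w hw => ?_⟩
  have hw' : ‖w‖ ≤ ‖c‖ + r := norm_le_of_mem_closedBall hw
  calc ‖F w - (gaussPoly P).eval w‖
      ≤ ‖F w - f.eval w‖ + ‖f.eval w - (gaussPoly P).eval w‖ := norm_sub_le_norm_sub_add_norm_sub ..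
    _ < ε := by linarith [hf w hw, hP w hw']

end Polynomials

/-! ### Disk arithmetic for polynomials -/

/-- A closed disk, given by the coordinates of its center and its radius. The field `K` is `ℚ` for
computations and `ℝ` for limit arguments. -/
@[ext]
structure Disk (K : Type*) where
  re : K
  im : K
  rad : K

/-- The disk in the complex plane with rational center and radius. -/
def Disk.toReal (d : Disk ℚ) : Disk ℝ := ⟨d.re, d.im, d.rad⟩

/-- The center of a disk as a complex number. -/
def Disk.center (d : Disk ℝ) : ℂ := ⟨d.re, d.im⟩

/-- The disk of radius `0` about `w`. -/
def Disk.ofPoint (w : ℂ) : Disk ℝ := ⟨w.re, w.im, 0⟩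

/-- Disks converge if their centers and their radii do. -/
noncomputable instance : TopologicalSpace (Disk ℝ) :=
  .induced (fun d => (d.center, d.rad)) inferInstance

namespace Disk

open Filter Topology

theorem continuous_center_rad : Continuous fun d : Disk ℝ => (d.center, d.rad) :=
  continuous_induced_dom

@[fun_prop]
theorem continuous_re : Continuous fun d : Disk ℝ => d.re :=
  Complex.continuous_re.comp continuous_center_rad.fst

@[fun_prop]
theorem continuous_im : Continuous fun d : Disk ℝ => d.im :=
  Complex.continuous_im.comp continuous_center_rad.fst

@[fun_prop]
theorem continuous_center : Continuous fun d : Disk ℝ => d.center := continuous_center_rad.fst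

@[fun_prop]
theorem continuous_rad : Continuous fun d : Disk ℝ => d.rad := continuous_center_rad.snd

@[fun_prop]
theorem continuous_mk {α : Type*} [TopologicalSpace α] {x y r : α → ℝ} (hx : Continuous x)
    (hy : Continuous y) (hr : Continuous r) : Continuous fun a => (⟨x a, y a, r a⟩ : Disk ℝ) :=
  continuous_induced_rng.2
    ((Complex.equivRealProdCLM.symm.continuous.comp (hx.prodMk hy)).prodMk hr)

theorem exists_forall_of_eventually_nhds_ofPoint {w : ℂ} {p : Disk ℝ → Prop}
    (h : ∀ᶠ d in 𝓝 (ofPoint w), p d) :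
    ∃ δ > 0, ∀ d : Disk ℝ, ‖d.center - w‖ < δ → |d.rad| < δ → p d := by
  rw [nhds_induced, eventually_comap] at h
  obtain ⟨δ, hδ, hp⟩ := Metric.eventually_nhds_iff.1 h
  refine ⟨δ, hδ, fun d hc hr => hp (max_lt ?_ ?_) d rfl⟩
  · exact (dist_eq_norm d.center w).trans_lt hc
  · exact (Real.dist_0_eq_abs d.rad).trans_lt hr

end Disk

section PolyDisk

variable {K : Type*} [Field K] [LinearOrder K]

/-- Horner's scheme in disk arithmetic: a disk that contains the values of the polynomial with the
coefficients `P` on the disk `d`. -/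
def polyDisk (d : Disk K) : List (ℕ × ℕ) → Disk K
  | [] => ⟨0, 0, 0⟩
  | a :: P =>
    { re := (ratOf a.1 : K) + (d.re * (polyDisk d P).re - d.im * (polyDisk d P).im)
      im := (ratOf a.2 : K) + (d.re * (polyDisk d P).im + d.im * (polyDisk d P).re)
      rad := (|d.re| + |d.im| + d.rad) * (polyDisk d P).rad
        + (|(polyDisk d P).re| + |(polyDisk d P).im|) * d.rad }

theorem polyDisk_toReal (d : Disk ℚ) (P : List (ℕ × ℕ)) :
    polyDisk d.toReal P = (polyDisk d P).toReal := by
  induction P with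
  | nil => ext <;> exact Rat.cast_zero.symm
  | cons a P ih =>
    rw [polyDisk, ih]
    ext <;> simp only [polyDisk, Disk.toReal] <;> push_cast <;> rfl

theorem center_polyDisk (d : Disk ℝ) (P : List (ℕ × ℕ)) :
    (polyDisk d P).center = (gaussPoly P).eval d.center := by
  induction P with
  | nil => rw [eval_gaussPoly_nil]; rfl
  | cons a P ih =>
    rw [eval_gaussPoly_cons, ← ih]
    apply Complex.ext <;> simp [polyDisk, Disk.center, gaussOf]

theorem norm_eval_gaussPoly_sub_le {d : Disk ℝ} {w : ℂ} (hw : ‖w - d.center‖ ≤ d.rad)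
    (P : List (ℕ × ℕ)) :
    ‖(gaussPoly P).eval w - (polyDisk d P).center‖ ≤ (polyDisk d P).rad := by
  rw [center_polyDisk]
  induction P with
  | nil => rw [eval_gaussPoly_nil, eval_gaussPoly_nil, sub_zero, norm_zero, polyDisk]
  | cons a P ih =>
    have hd : 0 ≤ d.rad := (norm_nonneg _).trans hw
    have hcenter : ‖d.center‖ ≤ |d.re| + |d.im| := Complex.norm_le_abs_re_add_abs_im _
    have hvalue : ‖(gaussPoly P).eval d.center‖ ≤ |(polyDisk d P).re| + |(polyDisk d P).im| := by
      rw [← center_polyDisk]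
      exact Complex.norm_le_abs_re_add_abs_im _
    rw [eval_gaussPoly_cons, eval_gaussPoly_cons, polyDisk]
    generalize (gaussPoly P).eval w = A at ih
    generalize (gaussPoly P).eval d.center = B at ih hvalue
    calc ‖gaussOf a + w * A - (gaussOf a + d.center * B)‖
        = ‖(w - d.center) * (A - B) + d.center * (A - B) + (w - d.center) * B‖ := by ring_nf
      _ ≤ ‖w - d.center‖ * ‖A - B‖ + ‖d.center‖ * ‖A - B‖ + ‖w - d.center‖ * ‖B‖ :=
          norm_add₃_le.trans_eq (by simp only [norm_mul])
      _ ≤ d.rad * (polyDisk d P).rad + (|d.re| + |d.im|) * (polyDisk d P).rad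
          + d.rad * (|(polyDisk d P).re| + |(polyDisk d P).im|) := by gcongr
      _ = _ := by ring

theorem polyDisk_ofPoint (w : ℂ) (P : List (ℕ × ℕ)) :
    polyDisk (Disk.ofPoint w) P = Disk.ofPoint ((gaussPoly P).eval w) := by
  have hcenter := center_polyDisk (Disk.ofPoint w) P
  refine Disk.ext (congrArg Complex.re hcenter) (congrArg Complex.im hcenter) ?_
  clear hcenter
  change (polyDisk (Disk.ofPoint w) P).rad = 0
  induction P with
  | nil => rfl
  | cons a P ih => rw [polyDisk, ih, Disk.ofPoint, mul_zero, mul_zero, add_zero]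

@[fun_prop]
theorem continuous_polyDisk (P : List (ℕ × ℕ)) : Continuous fun d : Disk ℝ => polyDisk d P := by
  induction P with
  | nil => exact continuous_const
  | cons a P ih => simp only [polyDisk]; fun_prop

end PolyDisk

section PolyDiskPrimrec

variable {α : Type*} [Primcodable α] {P : α → List (ℕ × ℕ)} {x y r : α → ℚ}

theorem exists_primrec_code_polyDisk (hP : Primrec P) (hx : RatPrimrec x) (hy : RatPrimrec y)
    (hr : RatPrimrec r) : ∃ c : α → ℕ × ℕ × ℕ, Primrec c ∧
      ∀ a, polyDisk ⟨x a, y a, r a⟩ (P a) = ⟨ratOf (c a).1, ratOf (c a).2.1, ratOf (c a).2.2⟩ := by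
  obtain ⟨re, hre, hre'⟩ := RatPrimrec.exists_ratOf_eq
    (g := fun q : α × (ℕ × ℕ) × (ℕ × ℕ × ℕ) =>
      ratOf q.2.1.1 + (x q.1 * ratOf q.2.2.1 - y q.1 * ratOf q.2.2.2.1)) (by fun_prop)
  obtain ⟨im, him, him'⟩ := RatPrimrec.exists_ratOf_eq
    (g := fun q : α × (ℕ × ℕ) × (ℕ × ℕ × ℕ) =>
      ratOf q.2.1.2 + (x q.1 * ratOf q.2.2.2.1 + y q.1 * ratOf q.2.2.1)) (by fun_prop)
  obtain ⟨rad, hrad, hrad'⟩ := RatPrimrec.exists_ratOf_eq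
    (g := fun q : α × (ℕ × ℕ) × (ℕ × ℕ × ℕ) => (|x q.1| + |y q.1| + r q.1) * ratOf q.2.2.2.2
      + (|ratOf q.2.2.1| + |ratOf q.2.2.2.1|) * r q.1) (by fun_prop)
  obtain ⟨z, hz⟩ := exists_ratOf_eq 0
  refine ⟨fun a => (P a).foldr (fun b s => (re (a, b, s), im (a, b, s), rad (a, b, s)))
    (z, z, z), Primrec.list_foldr
      (h := fun a q => (re (a, q), im (a, q), rad (a, q))) hP (Primrec.const _)
      (show Primrec fun q : α × (ℕ × ℕ) × (ℕ × ℕ × ℕ) =>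
        (re (q.1, q.2), im (q.1, q.2), rad (q.1, q.2)) by fun_prop), fun a => ?_⟩
  beta_reduce
  induction P a with
  | nil => simp only [polyDisk, List.foldr_nil, hz]
  | cons b l ih => simp only [polyDisk, ih, List.foldr_cons, hre', him', hrad', Rat.cast_id]

theorem ratPrimrec_re_polyDisk (hP : Primrec P) (hx : RatPrimrec x) (hy : RatPrimrec y)
    (hr : RatPrimrec r) : RatPrimrec fun a => (polyDisk ⟨x a, y a, r a⟩ (P a)).re := by
  obtain ⟨c, hc, h⟩ := exists_primrec_code_polyDisk hP hx hy hr
  simp only [h]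
  fun_prop

theorem ratPrimrec_im_polyDisk (hP : Primrec P) (hx : RatPrimrec x) (hy : RatPrimrec y)
    (hr : RatPrimrec r) : RatPrimrec fun a => (polyDisk ⟨x a, y a, r a⟩ (P a)).im := by
  obtain ⟨c, hc, h⟩ := exists_primrec_code_polyDisk hP hx hy hr
  simp only [h]
  fun_prop

theorem ratPrimrec_rad_polyDisk (hP : Primrec P) (hx : RatPrimrec x) (hy : RatPrimrec y)
    (hr : RatPrimrec r) : RatPrimrec fun a => (polyDisk ⟨x a, y a, r a⟩ (P a)).rad := by
  obtain ⟨c, hc, h⟩ := exists_primrec_code_polyDisk hP hx hy hr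
  simp only [h]
  fun_prop

end PolyDiskPrimrec

attribute [fun_prop] ratPrimrec_re_polyDisk ratPrimrec_im_polyDisk ratPrimrec_rad_polyDisk

/-! ### Conjugate functions -/

section ConjugateFunctions

open Metric Real

theorem abs_im_sub_im_le {f : ℂ → ℂ} {c z : ℂ} {ρ ε : ℝ} (hε : 0 < ε)
    (hf : DifferentiableOn ℂ f (ball c ρ)) (hre : ∀ w ∈ ball c ρ, |(f w).re| ≤ ε)
    (hz : z ∈ ball c ρ) : |(f z).im - (f c).im| ≤ 4 * ε * ‖z - c‖ / (ρ - ‖z - c‖) := by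
  have hρ : 0 < ρ := pos_of_mem_ball hz
  have hmaps : Set.MapsTo (fun w : ℂ => w + c) (ball 0 ρ) (ball c ρ) := fun w hw => by
    rwa [mem_ball_iff_norm, add_sub_cancel_right, ← mem_ball_zero_iff]
  have hbound : Set.MapsTo (fun w => f (w + c) - f c) (ball 0 ρ) {w | w.re ≤ 2 * ε} :=
      fun w hw => by
    have hw := abs_le.1 (hre _ (hmaps hw))
    have hc := abs_le.1 (hre c (mem_ball_self hρ))
    rw [Set.mem_ofPred_eq, sub_re]
    linarith
  have key := borelCaratheodory_zero (f := fun w => f (w + c) - f c) (z := z - c) (by linarith)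
    ((hf.comp (by fun_prop) hmaps).sub_const (f c)) hbound hρ
    (by rwa [mem_ball_zero_iff, ← mem_ball_iff_norm]) (by rw [zero_add, sub_self])
  rw [sub_add_cancel] at key
  calc |(f z).im - (f c).im| = |(f z - f c).im| := by rw [sub_im]
    _ ≤ ‖f z - f c‖ := abs_im_le_norm _
    _ ≤ 2 * (2 * ε) * ‖z - c‖ / (ρ - ‖z - c‖) := key
    _ = 4 * ε * ‖z - c‖ / (ρ - ‖z - c‖) := by ring

theorem im_sub_im_eq_of_re_eqOn {f g : ℂ → ℂ} {s : Set ℂ} (hs : IsOpen s) (hs' : IsConnected s)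
    (hf : AnalyticOnNhd ℂ f s) (hg : AnalyticOnNhd ℂ g s) (h : ∀ w ∈ s, (f w).re = (g w).re)
    {z c : ℂ} (hz : z ∈ s) (hc : c ∈ s) : (f z).im - (f c).im = (g z).im - (g c).im := by
  obtain ⟨a, ha⟩ := (hf.sub hg).eq_const_of_re_eq_const (c₀ := 0)
    (fun w hw => by rw [Pi.sub_apply, sub_re, h w hw, sub_self]) hs hs'
  have hz' := congrArg Complex.im (ha z hz)
  have hc' := congrArg Complex.im (ha c hc)
  rw [Pi.sub_apply, sub_im] at hz' hc'
  linarith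

theorem im_herglotzRieszKernel (w ζ : ℂ) :
    ((herglotzRieszKernel 0 w ζ).im : ℂ) =
      (1 / I) * ((starRingEnd ℂ ζ * w - ζ * starRingEnd ℂ w) / ((‖ζ - w‖ : ℝ) : ℂ) ^ 2) := by
  have hI : (1 / I : ℂ) = -I := by rw [one_div, inv_I]
  rw [herglotzRieszKernel_def, sub_zero, sub_zero, hI, ← ofReal_pow, Complex.sq_norm]
  apply Complex.ext
  · simp only [div_im, add_im, sub_re, normSq_apply, sub_im, add_re, ofReal_sub, ofReal_div,
      ofReal_mul, ofReal_add, div_re, mul_re, ofReal_re, ofReal_im, add_zero, sub_self, mul_zero,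
      sub_zero, mul_im, zero_mul, zero_div, neg_mul, neg_re, I_re, conj_re, conj_im,
      sub_neg_eq_add, mul_neg, I_im, one_mul, zero_sub, neg_neg]
    ring
  · simp [div_im, div_re, mul_re, normSq_apply]

theorem im_herglotzRieszKernel_zero (ζ : ℂ) : (herglotzRieszKernel 0 0 ζ).im = 0 := by
  have h := im_herglotzRieszKernel 0 ζ
  rwa [map_zero, mul_zero, mul_zero, sub_zero, zero_div, mul_zero, ofReal_eq_zero] at h

theorem im_sub_im_eq_circleAverage {Φ : ℂ → ℂ} {w : ℂ} {r : ℝ}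
    (hΦ : AnalyticOnNhd ℂ Φ (closedBall 0 r)) (hw : w ∈ ball 0 r) :
    (Φ w).im - (Φ 0).im =
      circleAverage (fun ζ => (herglotzRieszKernel 0 w ζ).im * (Φ ζ).re) 0 r := by
  have hr : 0 < r := pos_of_mem_ball hw
  have hg : ContinuousOn (fun ζ => (Φ ζ).re) (sphere 0 |r|) := by
    rw [abs_of_pos hr]
    exact continuous_re.comp_continuousOn (hΦ.continuousOn.mono sphere_subset_closedBall)
  have hgC : ContinuousOn (fun ζ => ((Φ ζ).re : ℂ)) (sphere 0 |r|) :=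
    continuous_ofReal.comp_continuousOn hg
  let h : ℂ → ℂ := fun v => circleAverage (fun ζ => herglotzRieszKernel 0 v ζ • ((Φ ζ).re : ℂ)) 0 r
  have hre : ∀ v ∈ ball (0 : ℂ) r, (Φ v).re = (h v).re := fun v hv => by
    rw [re_circleAverage_herglotzRieszKernel_smul hg.circleIntegrable' hv]
    exact (HarmonicOnNhd.circleAverage_re_herglotzRieszKernel_smul
      (fun ζ hζ => (hΦ ζ hζ).harmonicAt_re) hv).symm
  have him : ∀ v ∈ ball (0 : ℂ) r,
      (h v).im = circleAverage (fun ζ => (herglotzRieszKernel 0 v ζ).im * (Φ ζ).re) 0 r :=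
    fun v hv => by
      have hint : CircleIntegrable (fun ζ => herglotzRieszKernel 0 v ζ • ((Φ ζ).re : ℂ)) 0 r :=
        ((continuousOn_herglotzRieszKernel_sphere hv).smul hgC).circleIntegrable'
      refine (imCLM.circleAverage_comp_comm hint).symm.trans (congrArg (circleAverage · 0 r) ?_)
      ext ζ
      exact im_mul_ofReal _ _
  have h0 : (h 0).im = 0 := by
    rw [him 0 (mem_ball_self hr)]
    simp only [im_herglotzRieszKernel_zero, zero_mul, circleAverage_const]
  rw [im_sub_im_eq_of_re_eqOn isOpen_ball ((convex_ball 0 r).isConnected ⟨0, mem_ball_self hr⟩)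
    (hΦ.mono ball_subset_closedBall)
    (analyticOnNhd_circleAverage_herglotzRieszKernel_smul hgC.circleIntegrable') hre hw
    (mem_ball_self hr)]
  exact (congrArg₂ (· - ·) (him w hw) h0).trans (sub_zero _)

theorem circleAverage_im_herglotzRieszKernel_mul (u : ℂ → ℝ) (z₀ z : ℂ) (r : ℝ) :
    ((circleAverage (fun ζ => (herglotzRieszKernel 0 (z - z₀) ζ).im * u (z₀ + ζ)) 0 r : ℝ) : ℂ) =
      conjugatePoisson u z₀ r z := by
  have hconst : 1 / (2 * (π : ℂ) * I) = (((2 * π)⁻¹ : ℝ) : ℂ) * (1 / I) := by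
    push_cast
    field_simp
  rw [circleAverage_def, conjugatePoisson, smul_eq_mul, ofReal_mul,
    ← intervalIntegral.integral_ofReal, hconst, mul_assoc,
    ← intervalIntegral.integral_const_mul (1 / I)]
  congr 2
  ext θ
  have hζ : circleMap 0 r θ = r * exp (I * θ) := by rw [circleMap, zero_add, mul_comm I]
  have hconj : starRingEnd ℂ (r * exp (I * θ)) = r * exp (-(I * θ)) := by
    rw [map_mul, ← Complex.exp_conj, conj_ofReal, map_mul, conj_I, conj_ofReal, neg_mul]
  rw [ofReal_mul, im_herglotzRieszKernel, hζ, hconj]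
  ring

theorem im_sub_im_eq_conjugatePoisson {F : ℂ → ℂ} {u : ℂ → ℝ} {z₀ z : ℂ} {r : ℝ}
    (hF : AnalyticOnNhd ℂ F (closedBall z₀ r)) (hu : ∀ w ∈ closedBall z₀ r, u w = (F w).re)
    (hz : z ∈ ball z₀ r) :
    (((F z).im - (F z₀).im : ℝ) : ℂ) = conjugatePoisson u z₀ r z := by
  have hmem : ∀ ζ ∈ closedBall (0 : ℂ) r, z₀ + ζ ∈ closedBall z₀ r := fun ζ hζ => by
    rwa [mem_closedBall_iff_norm, add_sub_cancel_left, ← mem_closedBall_zero_iff]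
  have hΦ : AnalyticOnNhd ℂ (fun ζ => F (z₀ + ζ)) (closedBall 0 r) := fun ζ hζ =>
    (hF _ (hmem ζ hζ)).comp_of_eq (by fun_prop) rfl
  have key := im_sub_im_eq_circleAverage hΦ (w := z - z₀)
    (by rwa [mem_ball_zero_iff, ← mem_ball_iff_norm])
  rw [add_sub_cancel, add_zero] at key
  rw [key, ← circleAverage_im_herglotzRieszKernel_mul, ofReal_inj]
  refine circleAverage_congr_sphere fun ζ hζ => ?_
  rw [abs_of_pos (pos_of_mem_ball hz)] at hζ
  exact congrArg _ (hu _ (hmem ζ (sphere_subset_closedBall hζ))).symm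

theorem isHarmonicConjugateOn_re_im {F : ℂ → ℂ} {u v : ℂ → ℝ} {s : Set ℂ} {c : ℝ} (hs : IsOpen s)
    (hF : AnalyticOnNhd ℂ F s) (hu : ∀ w ∈ s, u w = (F w).re)
    (hv : ∀ w ∈ s, v w = (F w).im - c) : IsHarmonicConjugateOn u v s := by
  have hue : ∀ z ∈ s, u =ᶠ[nhds z] fun w => (F w).re := fun z hz =>
    Filter.eventually_of_mem (hs.mem_nhds hz) hu
  have hve : ∀ z ∈ s, v =ᶠ[nhds z] fun w => (F w - I * c).im := fun z hz =>
    Filter.eventually_of_mem (hs.mem_nhds hz) fun w hw => by simp [hv w hw]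
  have hF' : ∀ z ∈ s, HasFDerivAt F ((fderiv ℂ F z).restrictScalars ℝ) z := fun z hz =>
    (hF z hz).differentiableAt.hasFDerivAt.restrictScalars ℝ
  have hu' : ∀ z ∈ s, ∀ y, fderiv ℝ u z y = (fderiv ℂ F z y).re := fun z hz y => by
    rw [((reCLM.hasFDerivAt.comp z (hF' z hz)).congr_of_eventuallyEq (hue z hz)).fderiv]
    rfl
  have hv' : ∀ z ∈ s, ∀ y, fderiv ℝ v z y = (fderiv ℂ F z y).im := fun z hz y => by
    rw [((imCLM.hasFDerivAt.comp z ((hF' z hz).sub_const (I * c))).congr_of_eventuallyEq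
      (hve z hz)).fderiv]
    rfl
  have hI : ∀ z, fderiv ℂ F z I = I * fderiv ℂ F z 1 := fun z => by
    rw [← smul_eq_mul, ← map_smul, smul_eq_mul, mul_one]
  refine ⟨fun z hz => ?_, fun z hz => ?_, fun z hz => ?_, fun z hz => ?_⟩
  · exact (harmonicAt_congr_nhds (hue z hz)).2 (hF z hz).harmonicAt_re
  · exact (harmonicAt_congr_nhds (hve z hz)).2 ((hF z hz).sub analyticAt_const).harmonicAt_im
  · rw [hu' z hz, hv' z hz, hI, I_mul_im]
  · rw [hu' z hz, hv' z hz, hI, I_mul_re]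

end ConjugateFunctions

/-! ### Basic open sets -/

section BasicSets

open Filter Topology

/-- Left bound of the rectangle with index `k`. -/
def reLo (k : ℕ) : ℚ := ratOf k.unpair.2.unpair.1.unpair.1

/-- Right bound of the rectangle with index `k`. -/
def reHi (k : ℕ) : ℚ := ratOf k.unpair.2.unpair.1.unpair.2

/-- Lower bound of the rectangle with index `k`. -/
def imLo (k : ℕ) : ℚ := ratOf k.unpair.2.unpair.2.unpair.1

/-- Upper bound of the rectangle with index `k`. -/
def imHi (k : ℕ) : ℚ := ratOf k.unpair.2.unpair.2.unpair.2

/-- Half of the perimeter of the rectangle with index `k`. -/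
def halfPerimeter (k : ℕ) : ℚ := (reHi k - reLo k) + (imHi k - imLo k)

/-- A disk that contains the rectangle with index `k`. Its center is the lower left vertex, and its
radius bounds the diameter of the rectangle without a square root. -/
def boundingDisk (k : ℕ) : Disk ℚ := ⟨reLo k, imLo k, halfPerimeter k⟩

/-- A decidable condition on rational disks, sufficient for the disk `d` to be contained in the
basic set with index `k`. -/
def Disk.InBasic {K : Type*} [Field K] [LinearOrder K] (d : Disk K) (k : ℕ) : Prop :=
  (k.unpair.1 = 0 ∧ ((posRatOf k.unpair.2 : K) + d.rad) ^ 2 < d.re ^ 2 + d.im ^ 2) ∨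
  (k.unpair.1 ≠ 0 ∧ (reLo k : K) < d.re - d.rad ∧ d.re + d.rad < (reHi k : K) ∧
    (imLo k : K) < d.im - d.rad ∧ d.im + d.rad < (imHi k : K))

theorem coe_mem_basicSet_exterior {k : ℕ} (hk : k.unpair.1 = 0) (w : ℂ) :
    (w : Sphere) ∈ basicSet k ↔ (posRatOf k.unpair.2 : ℝ) < ‖w‖ := by
  rw [basicSet, if_pos hk, exteriorDisk, Set.mem_compl_iff,
    OnePoint.coe_injective.mem_set_image, mem_closedBall_zero_iff, not_le]

theorem coe_mem_basicSet_rect {k : ℕ} (hk : k.unpair.1 ≠ 0) (w : ℂ) :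
    (w : Sphere) ∈ basicSet k ↔ (reLo k : ℝ) < w.re ∧ w.re < (reHi k : ℝ) ∧
      (imLo k : ℝ) < w.im ∧ w.im < (imHi k : ℝ) := by
  rw [basicSet, if_neg hk, openRect, OnePoint.coe_injective.mem_set_image]
  rfl

theorem exists_rect_index (a b c d : ℚ) :
    ∃ k, k.unpair.1 ≠ 0 ∧ reLo k = a ∧ reHi k = b ∧ imLo k = c ∧ imHi k = d := by
  obtain ⟨a, rfl⟩ := exists_ratOf_eq a
  obtain ⟨b, rfl⟩ := exists_ratOf_eq b
  obtain ⟨c, rfl⟩ := exists_ratOf_eq c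
  obtain ⟨d, rfl⟩ := exists_ratOf_eq d
  exact ⟨Nat.pair 1 (Nat.pair (Nat.pair a b) (Nat.pair c d)), by simp [reLo, reHi, imLo, imHi]⟩

theorem exists_rect_index_near (w : ℂ) {δ : ℝ} (hδ : 0 < δ) :
    ∃ k, k.unpair.1 ≠ 0 ∧ (w : Sphere) ∈ basicSet k ∧ (halfPerimeter k : ℝ) < δ := by
  obtain ⟨a, ha, ha'⟩ := exists_rat_btwn (show w.re - δ / 4 < w.re by linarith)
  obtain ⟨b, hb, hb'⟩ := exists_rat_btwn (show w.re < w.re + δ / 4 by linarith)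
  obtain ⟨c, hc, hc'⟩ := exists_rat_btwn (show w.im - δ / 4 < w.im by linarith)
  obtain ⟨d, hd, hd'⟩ := exists_rat_btwn (show w.im < w.im + δ / 4 by linarith)
  obtain ⟨k, hk, rfl, rfl, rfl, rfl⟩ := exists_rect_index a b c d
  refine ⟨k, hk, (coe_mem_basicSet_rect hk w).2 ⟨ha', hb, hc', hd⟩, ?_⟩
  rw [halfPerimeter]
  push_cast
  linarith

theorem norm_sub_center_boundingDisk_le {k : ℕ} (hk : k.unpair.1 ≠ 0) {w : ℂ}
    (hw : (w : Sphere) ∈ basicSet k) :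
    ‖w - (boundingDisk k).toReal.center‖ ≤ (boundingDisk k).toReal.rad := by
  obtain ⟨h1, h2, h3, h4⟩ := (coe_mem_basicSet_rect hk w).1 hw
  refine (Complex.norm_le_abs_re_add_abs_im _).trans ?_
  simp only [sub_re, sub_im, Disk.center, Disk.toReal, boundingDisk, halfPerimeter]
  rw [abs_of_pos (by linarith), abs_of_pos (by linarith)]
  push_cast
  linarith

theorem infinite_setOf_mem_basicSet (w : ℂ) : {k | (w : Sphere) ∈ basicSet k}.Infinite := by
  obtain ⟨k, hk, hw, -⟩ := exists_rect_index_near w one_pos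
  have hinj : Function.Injective fun n : ℕ => Nat.pair (n + 1) k.unpair.2 := fun m n h => by
    simpa using (Nat.pair_eq_pair.1 h).1
  refine (Set.infinite_range_of_injective hinj).mono ?_
  rintro _ ⟨n, rfl⟩
  rw [coe_mem_basicSet_rect hk] at hw
  refine (coe_mem_basicSet_rect (by simp) w).2 ?_
  simpa [reLo, reHi, imLo, imHi] using hw

theorem exists_isPointName_extending {L : List ℕ} {w : ℂ}
    (hL : ∀ k ∈ L, (w : Sphere) ∈ basicSet k) :
    ∃ p, IsPointName p w ∧ IsFragment (fun i => L[i]?) p := by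
  classical
  obtain ⟨k₀, -, hk₀, -⟩ := exists_rect_index_near w one_pos
  refine ⟨fun i => (L[i]?).getD
    (if (w : Sphere) ∈ basicSet (i - L.length) then i - L.length else k₀),
    fun k => ⟨?_, fun hk => ⟨L.length + k, by simp [hk]⟩⟩, fun i x hx => by simp [hx]⟩
  rintro ⟨i, rfl⟩
  beta_reduce
  rcases hi : L[i]? with _ | x
  · rw [Option.getD_none]
    split_ifs with h
    exacts [h, hk₀]
  · exact hL x (List.mem_of_getElem? hi)

namespace Disk

theorem inBasic_toReal_iff {d : Disk ℚ} {k : ℕ} : d.toReal.InBasic k ↔ d.InBasic k := by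
  simp only [InBasic, toReal, Rat.cast_id]
  norm_cast

theorem InBasic.coe_mem_basicSet {d : Disk ℝ} {k : ℕ} (h : d.InBasic k) {w : ℂ}
    (hw : ‖w - d.center‖ ≤ d.rad) : (w : Sphere) ∈ basicSet k := by
  rcases h with ⟨hk, h⟩ | ⟨hk, h1, h2, h3, h4⟩
  · rw [coe_mem_basicSet_exterior hk]
    have hcenter : (posRatOf k.unpair.2 : ℝ) + d.rad < ‖d.center‖ := by
      refine lt_of_pow_lt_pow_left₀ 2 (norm_nonneg _) (h.trans_eq ?_)
      rw [Complex.sq_norm, center, Complex.normSq_mk]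
      ring
    linarith [norm_le_norm_add_norm_sub w d.center]
  · have hre := abs_le.1 ((Complex.abs_re_le_norm (w - d.center)).trans hw)
    have him := abs_le.1 ((Complex.abs_im_le_norm (w - d.center)).trans hw)
    simp only [sub_re, sub_im, center] at hre him
    exact (coe_mem_basicSet_rect hk w).2 ⟨by linarith, by linarith, by linarith, by linarith⟩

theorem inBasic_ofPoint_iff {w : ℂ} {k : ℕ} :
    (ofPoint w).InBasic k ↔ (w : Sphere) ∈ basicSet k := by
  refine ⟨fun h => h.coe_mem_basicSet (sub_self w ▸ norm_zero.le), fun h => ?_⟩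
  by_cases hk : k.unpair.1 = 0
  · have hpos : (0 : ℝ) ≤ posRatOf k.unpair.2 := by unfold posRatOf; positivity
    refine Or.inl ⟨hk, ?_⟩
    simp only [ofPoint]
    rw [add_zero, pow_two w.re, pow_two w.im, ← Complex.normSq_apply, ← Complex.sq_norm]
    exact pow_lt_pow_left₀ ((coe_mem_basicSet_exterior hk w).1 h) hpos two_ne_zero
  · exact Or.inr ⟨hk, by simpa [ofPoint] using (coe_mem_basicSet_rect hk w).1 h⟩

theorem isOpen_setOf_inBasic (k : ℕ) : IsOpen {d : Disk ℝ | d.InBasic k} := by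
  refine IsOpen.union (isOpen_const.and ?_) (isOpen_const.and ?_)
  · exact isOpen_lt (by fun_prop) (by fun_prop)
  · refine IsOpen.and ?_ (IsOpen.and ?_ (IsOpen.and ?_ ?_)) <;>
      exact isOpen_lt (by fun_prop) (by fun_prop)

theorem eventually_inBasic {w : ℂ} {k : ℕ} (h : (w : Sphere) ∈ basicSet k) :
    ∀ᶠ d in 𝓝 (ofPoint w), d.InBasic k :=
  (isOpen_setOf_inBasic k).mem_nhds (inBasic_ofPoint_iff.2 h)

theorem exists_boundingDisk_of_eventually_nhds_ofPoint {w : ℂ} {p : Disk ℝ → Prop}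
    (h : ∀ᶠ d in 𝓝 (ofPoint w), p d) :
    ∃ k, k.unpair.1 ≠ 0 ∧ (w : Sphere) ∈ basicSet k ∧ p (boundingDisk k).toReal := by
  obtain ⟨δ, hδ, hp⟩ := exists_forall_of_eventually_nhds_ofPoint h
  obtain ⟨k, hk, hw, hlt⟩ := exists_rect_index_near w hδ
  have hle := norm_sub_center_boundingDisk_le hk hw
  refine ⟨k, hk, hw, hp _ ?_ ?_⟩
  · rw [norm_sub_rev]
    exact hle.trans_lt hlt
  · rw [abs_of_nonneg ((norm_nonneg _).trans hle)]
    exact hlt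

end Disk

section BasicSetPrimrec

variable {α : Type*} [Primcodable α] {k : α → ℕ}

@[fun_prop]
theorem ratPrimrec_reLo (hk : Primrec k) : RatPrimrec fun a => reLo (k a) := by
  unfold reLo; fun_prop

@[fun_prop]
theorem ratPrimrec_reHi (hk : Primrec k) : RatPrimrec fun a => reHi (k a) := by
  unfold reHi; fun_prop

@[fun_prop]
theorem ratPrimrec_imLo (hk : Primrec k) : RatPrimrec fun a => imLo (k a) := by
  unfold imLo; fun_prop

@[fun_prop]
theorem ratPrimrec_imHi (hk : Primrec k) : RatPrimrec fun a => imHi (k a) := by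
  unfold imHi; fun_prop

@[fun_prop]
theorem ratPrimrec_halfPerimeter (hk : Primrec k) : RatPrimrec fun a => halfPerimeter (k a) := by
  unfold halfPerimeter; fun_prop

@[fun_prop]
theorem primrecPred_inBasic {x y r : α → ℚ} (hx : RatPrimrec x) (hy : RatPrimrec y)
    (hr : RatPrimrec r) (hk : Primrec k) :
    PrimrecPred fun a => Disk.InBasic ⟨x a, y a, r a⟩ (k a) := by
  unfold Disk.InBasic
  simp only [Rat.cast_id]
  fun_prop

end BasicSetPrimrec

end BasicSets

/-! ### Certificates -/

/-- The disk of radius `2 * h` about the point with index `(i, j)` of the square grid of mesh `h`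
with `2 * N + 1` points on a side that is centered at the center of the disk `d`. -/
def gridDisk (d : Disk ℚ) (h : ℚ) (N i j : ℕ) : Disk ℚ :=
  ⟨d.re + h * ((i : ℚ) - N), d.im + h * ((j : ℚ) - N), 2 * h⟩

/-- A list of basic sets, the index of a basic set, a bound on the resources of every step of a
machine, and a number of steps. -/
abbrev CellData : Type := List ℕ × ℕ × ℕ × ℕ

/-- The data `c` certify that the function named by the oracle `o` and the machine `e` differs by at
most `ε` on the disk `d` from the real part of the polynomial with the coefficients `P`: the disk is
contained in the listed basic sets, the machine answers to this list with the rectangle `c.2.1`, and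
the real parts of this rectangle are `ε`-close to those of the values of the polynomial. -/
structure CellCert (o : ℕ → Option ℕ) (e : Nat.Partrec.Code) (P : List (ℕ × ℕ)) (ε : ℚ)
    (d : Disk ℚ) (c : CellData) : Prop where
  inBasic : ∀ k ∈ c.1, d.InBasic k
  mem_output : c.2.1 ∈ simulatedOutput o (fun i => c.1[i]?) e c.2.2.1 c.2.2.2
  isRect : c.2.1.unpair.1 ≠ 0
  sub_reLo_le : (polyDisk d P).re + (polyDisk d P).rad - reLo c.2.1 ≤ ε
  reHi_sub_le : reHi c.2.1 - ((polyDisk d P).re - (polyDisk d P).rad) ≤ ε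

/-- Every grid disk that may meet `d` has a certificate with a code below `b`, and the grid is so
large that these disks cover `d`. -/
structure CoverCert (o : ℕ → Option ℕ) (b : ℕ) (e : Nat.Partrec.Code) (P : List (ℕ × ℕ)) (ε : ℚ)
    (d : Disk ℚ) (h : ℚ) (N : ℕ) : Prop where
  rad_le : d.rad ≤ N * h
  exists_cellCert : ∀ i < 2 * N + 1, ∀ j < 2 * N + 1,
    (d.rad + 2 * h) ^ 2 < (h * ((i : ℚ) - N)) ^ 2 + (h * ((j : ℚ) - N)) ^ 2 ∨
      ∃ w < b, CellCert o e P ε (gridDisk d h N i j) (Denumerable.ofNat CellData w)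

/-- The inequalities by which an approximation of `u` up to `ε` on the disk of radius `ρ` about a
point of `d₀` determines the increment of the conjugate of `u` from this point to a point of `d₁`
up to `τ`, in the presence of a lower bound `a` for the radius of the disk where `u` is given. The
number `σ` bounds the distance of the centers. -/
structure RadiiFit {K : Type*} [Field K] [LinearOrder K] (d₀ d₁ : Disk K) (a ρ σ ε τ : K) :
    Prop where
  eps_pos : 0 < ε
  sigma_pos : 0 < σ
  add_rad_lt : ρ + 2 * d₀.rad < a
  sq_lt_sq : (d₁.re - d₀.re) ^ 2 + (d₁.im - d₀.im) ^ 2 < σ ^ 2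
  add_lt_rho : σ + d₀.rad + d₁.rad < ρ
  error_lt : 4 * ε * ρ < τ * (ρ - σ - d₀.rad - d₁.rad)

/-- A disk for the value at a point of `d₁` of the conjugate that vanishes at a point of `d₀`, if
up to an error `τ` it is the increment of the imaginary part of the polynomial with coefficients
`P`. -/
def conjugateDisk {K : Type*} [Field K] [LinearOrder K] (d₀ d₁ : Disk K) (P : List (ℕ × ℕ))
    (τ : K) : Disk K :=
  ⟨(polyDisk d₁ P).im - (polyDisk d₀ P).im, 0, (polyDisk d₁ P).rad + (polyDisk d₀ P).rad + τ⟩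

/-- A certificate for a value of the conjugate: the code of the machine that names `u`, places on
the tapes where the names of `z₀`, `R` and `z` list the basic sets with the indices `centerIdx`,
`radiusIdx` and `pointIdx`, a polynomial, the numbers in `RadiiFit`, and the mesh `h` and the size
of a grid. -/
structure Certificate where
  code : ℕ
  centerPos : ℕ
  centerIdx : ℕ
  radiusPos : ℕ
  radiusIdx : ℕ
  pointPos : ℕ
  pointIdx : ℕ
  poly : List (ℕ × ℕ)
  ρ : ℚ
  σ : ℚ
  ε : ℚ
  τ : ℚ
  h : ℚ
  gridSize : ℕ

/-- What a machine with the graph of `triple (functionTape X e) p₀ pR` as oracle learns about `X`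
from the list `H` of replies. The bit of `X` at `x` stands in cell `3 * x + 3` of this tape. -/
def knownOracle (H : List ℕ) (x : ℕ) : Option ℕ := oracleReply H (Nat.pair (3 * x + 3) 1)

namespace Certificate

/-- A notation of certificates by natural numbers. -/
def ofNat (n : ℕ) : Certificate :=
  let c := Denumerable.ofNat (ℕ × (ℕ × ℕ) × (ℕ × ℕ) × (ℕ × ℕ) × List (ℕ × ℕ) ×
    (ℕ × ℕ × ℕ × ℕ × ℕ) × ℕ) n
  { code := c.1
    centerPos := c.2.1.1
    centerIdx := c.2.1.2
    radiusPos := c.2.2.1.1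
    radiusIdx := c.2.2.1.2
    pointPos := c.2.2.2.1.1
    pointIdx := c.2.2.2.1.2
    poly := c.2.2.2.2.1
    ρ := ratOf c.2.2.2.2.2.1.1
    σ := ratOf c.2.2.2.2.2.1.2.1
    ε := ratOf c.2.2.2.2.2.1.2.2.1
    τ := ratOf c.2.2.2.2.2.1.2.2.2.1
    h := ratOf c.2.2.2.2.2.1.2.2.2.2
    gridSize := c.2.2.2.2.2.2 }

theorem ofNat_surjective : Function.Surjective ofNat := fun C => by
  obtain ⟨ρ, hρ⟩ := exists_ratOf_eq C.ρ
  obtain ⟨σ, hσ⟩ := exists_ratOf_eq C.σ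
  obtain ⟨ε, hε⟩ := exists_ratOf_eq C.ε
  obtain ⟨τ, hτ⟩ := exists_ratOf_eq C.τ
  obtain ⟨h, hh⟩ := exists_ratOf_eq C.h
  refine ⟨Encodable.encode (C.code, (C.centerPos, C.centerIdx), (C.radiusPos, C.radiusIdx),
    (C.pointPos, C.pointIdx), C.poly, (ρ, σ, ε, τ, h), C.gridSize), ?_⟩
  rw [ofNat, Denumerable.ofNat_encode, hρ, hσ, hε, hτ, hh]

/-- The machine whose code is read off the tape. -/
def machine (C : Certificate) : Nat.Partrec.Code := Denumerable.ofNat Nat.Partrec.Code C.code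

/-- The replies `H` confirm what the certificate says about the tapes. The oracle is the graph of
the interleaved sequences `functionTape X e` and the names of `z₀` and `R`, and the input tape
contains the name of `z`. -/
structure ReadsTape (C : Certificate) (H : List ℕ) : Prop where
  code : oracleReply H (Nat.pair 0 C.code) = some 1
  center : oracleReply H (Nat.pair (3 * C.centerPos + 1) C.centerIdx) = some 1
  radius : oracleReply H (Nat.pair (3 * C.radiusPos + 2) C.radiusIdx) = some 1
  point : inputReply H C.pointPos = some C.pointIdx

/-- The replies `H` and cell certificates with codes below `b` confirm that the value of the
conjugate lies in the basic set with index `k`. -/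
structure Valid (C : Certificate) (H : List ℕ) (b k : ℕ) : Prop where
  readsTape : C.ReadsTape H
  isRect : C.centerIdx.unpair.1 ≠ 0 ∧ C.radiusIdx.unpair.1 ≠ 0 ∧ C.pointIdx.unpair.1 ≠ 0
  h_pos : 0 < C.h
  radiiFit : RadiiFit (boundingDisk C.centerIdx) (boundingDisk C.pointIdx) (reLo C.radiusIdx)
    C.ρ C.σ C.ε C.τ
  coverCert : CoverCert (knownOracle H) b C.machine C.poly C.ε
    ⟨reLo C.centerIdx, imLo C.centerIdx, C.ρ + halfPerimeter C.centerIdx⟩ C.h C.gridSize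
  inBasic : (conjugateDisk (boundingDisk C.centerIdx) (boundingDisk C.pointIdx) C.poly
    C.τ).InBasic k

end Certificate

section CertificatePrimrec

variable {α : Type*} [Primcodable α]

@[fun_prop]
theorem primrec_inputReply {H : α → List ℕ} {n : α → ℕ} (hH : Primrec H) (hn : Primrec n) :
    Primrec fun a => inputReply (H a) (n a) := by
  unfold inputReply; fun_prop

@[fun_prop]
theorem primrec_oracleReply {H : α → List ℕ} {n : α → ℕ} (hH : Primrec H) (hn : Primrec n) :
    Primrec fun a => oracleReply (H a) (n a) := by
  unfold oracleReply; fun_prop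

@[fun_prop]
theorem primrec_knownOracle {H : α → List ℕ} {x : α → ℕ} (hH : Primrec H) (hx : Primrec x) :
    Primrec fun a => knownOracle (H a) (x a) := by
  unfold knownOracle; fun_prop

theorem primrecPred_cellCert {o : α → ℕ → Option ℕ} {e : α → Nat.Partrec.Code}
    {P : α → List (ℕ × ℕ)} {ε x y r : α → ℚ} {c : α → CellData}
    (ho : Primrec fun q : α × ℕ => o q.1 q.2) (he : Primrec e) (hP : Primrec P)
    (hε : RatPrimrec ε) (hx : RatPrimrec x) (hy : RatPrimrec y) (hr : RatPrimrec r)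
    (hc : Primrec c) :
    PrimrecPred fun a => CellCert (o a) (e a) (P a) (ε a) ⟨x a, y a, r a⟩ (c a) := by
  have hsim : PrimrecPred fun a => (c a).2.1 ∈
      simulatedOutput (o a) (fun i => (c a).1[i]?) (e a) (c a).2.2.1 (c a).2.2.2 :=
    (primrecPred_exists_mem (p := fun a n => n = (c a).2.1)
      (primrec_simulatedOutput ho (by fun_prop) he (by fun_prop) (by fun_prop))
      (by fun_prop)).of_eq fun a => exists_eq_right
  have hin : PrimrecPred fun a => ∀ k ∈ (c a).1, Disk.InBasic ⟨x a, y a, r a⟩ k :=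
    primrecPred_forall_mem (by fun_prop) (by fun_prop)
  have hrest : PrimrecPred fun a => (c a).2.1.unpair.1 ≠ 0 ∧
      (polyDisk ⟨x a, y a, r a⟩ (P a)).re + (polyDisk ⟨x a, y a, r a⟩ (P a)).rad
        - reLo (c a).2.1 ≤ ε a ∧
      reHi (c a).2.1 - ((polyDisk ⟨x a, y a, r a⟩ (P a)).re
        - (polyDisk ⟨x a, y a, r a⟩ (P a)).rad) ≤ ε a := by
    fun_prop
  exact (hin.and (hsim.and hrest)).of_eq fun a =>
    ⟨fun ⟨h1, h2, h3, h4, h5⟩ => ⟨h1, h2, h3, h4, h5⟩,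
      fun ⟨h1, h2, h3, h4, h5⟩ => ⟨h1, h2, h3, h4, h5⟩⟩

theorem primrecPred_coverCert {o : α → ℕ → Option ℕ} {b N : α → ℕ} {e : α → Nat.Partrec.Code}
    {P : α → List (ℕ × ℕ)} {ε x y r h : α → ℚ} (ho : Primrec fun q : α × ℕ => o q.1 q.2)
    (hb : Primrec b) (he : Primrec e) (hP : Primrec P) (hε : RatPrimrec ε) (hx : RatPrimrec x)
    (hy : RatPrimrec y) (hr : RatPrimrec r) (hh : RatPrimrec h) (hN : Primrec N) :
    PrimrecPred fun a =>
      CoverCert (o a) (b a) (e a) (P a) (ε a) ⟨x a, y a, r a⟩ (h a) (N a) := by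
  have hcell : PrimrecPred fun a => ∀ i < 2 * N a + 1, ∀ j < 2 * N a + 1,
      (r a + 2 * h a) ^ 2 < (h a * ((i : ℚ) - N a)) ^ 2 + (h a * ((j : ℚ) - N a)) ^ 2 ∨
        ∃ w < b a, CellCert (o a) (e a) (P a) (ε a) (gridDisk ⟨x a, y a, r a⟩ (h a) (N a) i j)
          (Denumerable.ofNat CellData w) := by
    refine primrecPred_forall_lt (by fun_prop) (primrecPred_forall_lt (by fun_prop) ?_)
    refine PrimrecPred.or (by fun_prop) (primrecPred_exists_lt (by fun_prop) ?_)
    exact primrecPred_cellCert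
      (primrec_comp_fst ho (h := fun q : ((α × ℕ) × ℕ) × ℕ => q.1.1.1) (by fun_prop))
      (by fun_prop) (by fun_prop) (by fun_prop) (by fun_prop) (by fun_prop) (by fun_prop)
      (by fun_prop)
  have hrad : PrimrecPred fun a => r a ≤ N a * h a := by fun_prop
  exact (hrad.and hcell).of_eq fun a => ⟨fun ⟨h1, h2⟩ => ⟨h1, h2⟩, fun ⟨h1, h2⟩ => ⟨h1, h2⟩⟩

theorem primrecPred_radiiFit {x₀ y₀ r₀ x₁ y₁ r₁ a ρ σ ε τ : α → ℚ} (hx₀ : RatPrimrec x₀)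
    (hy₀ : RatPrimrec y₀) (hr₀ : RatPrimrec r₀) (hx₁ : RatPrimrec x₁) (hy₁ : RatPrimrec y₁)
    (hr₁ : RatPrimrec r₁) (ha : RatPrimrec a) (hρ : RatPrimrec ρ) (hσ : RatPrimrec σ)
    (hε : RatPrimrec ε) (hτ : RatPrimrec τ) :
    PrimrecPred fun i => RadiiFit ⟨x₀ i, y₀ i, r₀ i⟩ ⟨x₁ i, y₁ i, r₁ i⟩ (a i) (ρ i) (σ i) (ε i)
      (τ i) := by
  have h : PrimrecPred fun i => 0 < ε i ∧ 0 < σ i ∧ ρ i + 2 * r₀ i < a i ∧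
      (x₁ i - x₀ i) ^ 2 + (y₁ i - y₀ i) ^ 2 < σ i ^ 2 ∧ σ i + r₀ i + r₁ i < ρ i ∧
      4 * ε i * ρ i < τ i * (ρ i - σ i - r₀ i - r₁ i) := by
    fun_prop
  exact h.of_eq fun i => ⟨fun ⟨h1, h2, h3, h4, h5, h6⟩ => ⟨h1, h2, h3, h4, h5, h6⟩,
    fun ⟨h1, h2, h3, h4, h5, h6⟩ => ⟨h1, h2, h3, h4, h5, h6⟩⟩

theorem Certificate.primrecPred_readsTape :
    PrimrecPred fun q : List ℕ × ℕ => (Certificate.ofNat q.2).ReadsTape q.1 := by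
  have h : PrimrecPred fun q : List ℕ × ℕ =>
      oracleReply q.1 (Nat.pair 0 (ofNat q.2).code) = some 1 ∧
      oracleReply q.1 (Nat.pair (3 * (ofNat q.2).centerPos + 1) (ofNat q.2).centerIdx) = some 1 ∧
      oracleReply q.1 (Nat.pair (3 * (ofNat q.2).radiusPos + 2) (ofNat q.2).radiusIdx) = some 1 ∧
      inputReply q.1 (ofNat q.2).pointPos = some (ofNat q.2).pointIdx := by
    simp only [ofNat]
    fun_prop
  exact h.of_eq fun q => ⟨fun ⟨h1, h2, h3, h4⟩ => ⟨h1, h2, h3, h4⟩,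
    fun ⟨h1, h2, h3, h4⟩ => ⟨h1, h2, h3, h4⟩⟩

theorem Certificate.primrecPred_valid : PrimrecPred fun q : List ℕ × ℕ =>
    (Certificate.ofNat q.2.unpair.2.unpair.1).Valid q.1 q.2.unpair.2.unpair.2 q.2.unpair.1 := by
  have hreads : PrimrecPred fun q : List ℕ × ℕ =>
      (Certificate.ofNat q.2.unpair.2.unpair.1).ReadsTape q.1 :=
    primrecPred_readsTape.comp (f := fun q : List ℕ × ℕ => (q.1, q.2.unpair.2.unpair.1))
      (by fun_prop)
  have hrect : PrimrecPred fun n => ((ofNat n).centerIdx.unpair.1 ≠ 0 ∧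
      (ofNat n).radiusIdx.unpair.1 ≠ 0 ∧ (ofNat n).pointIdx.unpair.1 ≠ 0) ∧ 0 < (ofNat n).h := by
    simp only [ofNat]
    fun_prop
  have hfit : PrimrecPred fun n => RadiiFit (boundingDisk (ofNat n).centerIdx)
      (boundingDisk (ofNat n).pointIdx) (reLo (ofNat n).radiusIdx) (ofNat n).ρ (ofNat n).σ
      (ofNat n).ε (ofNat n).τ := by
    simp only [ofNat]
    apply primrecPred_radiiFit <;> fun_prop
  have hcover : PrimrecPred fun q : List ℕ × ℕ =>
      CoverCert (knownOracle q.1) q.2.unpair.2.unpair.2 (ofNat q.2.unpair.2.unpair.1).machine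
        (ofNat q.2.unpair.2.unpair.1).poly (ofNat q.2.unpair.2.unpair.1).ε
        ⟨reLo (ofNat q.2.unpair.2.unpair.1).centerIdx, imLo (ofNat q.2.unpair.2.unpair.1).centerIdx,
          (ofNat q.2.unpair.2.unpair.1).ρ
            + halfPerimeter (ofNat q.2.unpair.2.unpair.1).centerIdx⟩
        (ofNat q.2.unpair.2.unpair.1).h (ofNat q.2.unpair.2.unpair.1).gridSize := by
    simp only [machine, ofNat]
    apply primrecPred_coverCert <;> fun_prop
  have hin : PrimrecPred fun s : ℕ =>
      (conjugateDisk (boundingDisk (ofNat s.unpair.2.unpair.1).centerIdx)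
        (boundingDisk (ofNat s.unpair.2.unpair.1).pointIdx) (ofNat s.unpair.2.unpair.1).poly
        (ofNat s.unpair.2.unpair.1).τ).InBasic s.unpair.1 := by
    simp only [conjugateDisk, boundingDisk, ofNat]
    fun_prop
  have hcode : Primrec fun q : List ℕ × ℕ => q.2.unpair.2.unpair.1 := by fun_prop
  exact (hreads.and ((hrect.comp hcode).and ((hfit.comp hcode).and (hcover.and
    (hin.comp Primrec.snd))))).of_eq fun q =>
    ⟨fun ⟨h1, ⟨h2, h3⟩, h4, h5, h6⟩ => ⟨h1, h2, h3, h4, h5, h6⟩,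
      fun ⟨h1, h2, h3, h4, h5, h6⟩ => ⟨h1, ⟨h2, h3⟩, h4, h5, h6⟩⟩

end CertificatePrimrec

/-! ### Soundness of certificates -/

theorem bit_eq_one_iff {X : Set ℕ} {n : ℕ} : bit X n = 1 ↔ n ∈ X := by
  simp [bit]

theorem triple_zero (a b c : ℕ → ℕ) : triple a b c 0 = a 0 := rfl

theorem triple_three_mul_add_three (a b c : ℕ → ℕ) (n : ℕ) :
    triple a b c (3 * n + 3) = a (n + 1) := by
  rw [triple, if_pos (by omega), show (3 * n + 3) / 3 = n + 1 by omega]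

theorem triple_three_mul_add_one (a b c : ℕ → ℕ) (n : ℕ) : triple a b c (3 * n + 1) = b n := by
  rw [triple, if_neg (by omega), if_pos (by omega), show (3 * n + 1) / 3 = n by omega]

theorem triple_three_mul_add_two (a b c : ℕ → ℕ) (n : ℕ) : triple a b c (3 * n + 2) = c n := by
  rw [triple, if_neg (by omega), if_neg (by omega), show (3 * n + 2) / 3 = n by omega]

section Tape

variable {H : List ℕ} {X : Set ℕ} {e : Nat.Partrec.Code} {p₀ pR p : ℕ → ℕ}

theorem eq_of_oracleReply_pair_eq_one {T : ℕ → ℕ} {n x : ℕ}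
    (hH : IsFragment (oracleReply H) (bit (graphSet T)))
    (h : oracleReply H (Nat.pair n x) = some 1) : T n = x :=
  pair_mem_graphSet.1 (bit_eq_one_iff.1 (hH _ _ h))

theorem oracleReply_pair_eq_one {T : ℕ → ℕ} {n x b : ℕ}
    (hH : CoversUpTo (oracleReply H) (bit (graphSet T)) b) (h : T n = x) (hb : Nat.pair n x ≤ b) :
    oracleReply H (Nat.pair n x) = some 1 := by
  rw [hH _ hb, bit_eq_one_iff.2 (pair_mem_graphSet.2 h)]

theorem bit_graphSet_triple (X : Set ℕ) (e : Nat.Partrec.Code) (p₀ pR : ℕ → ℕ) (x : ℕ) :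
    bit (graphSet (triple (functionTape X e) p₀ pR)) (Nat.pair (3 * x + 3) 1) = bit X x := by
  classical
  rw [bit, pair_mem_graphSet, triple_three_mul_add_three, functionTape, bit_eq_one_iff, bit]

theorem isFragment_knownOracle
    (hH : IsFragment (oracleReply H) (bit (graphSet (triple (functionTape X e) p₀ pR)))) :
    IsFragment (knownOracle H) (bit X) := fun x _ h =>
  (bit_graphSet_triple X e p₀ pR x).symm.trans (hH _ _ h)

theorem coversUpTo_knownOracle {b : ℕ}
    (hH : CoversUpTo (oracleReply H) (bit (graphSet (triple (functionTape X e) p₀ pR)))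
      (Nat.pair (3 * b + 3) 1)) : CoversUpTo (knownOracle H) (bit X) b := fun x hx => by
  have hpair : StrictMono fun y => Nat.pair (3 * y + 3) 1 := fun _ _ h =>
    Nat.pair_lt_pair_left 1 (by omega)
  rw [knownOracle, hH _ (hpair.monotone hx), bit_graphSet_triple]

theorem Certificate.ReadsTape.eq {C : Certificate} (hC : C.ReadsTape H)
    (hH : IsFragment (oracleReply H) (bit (graphSet (triple (functionTape X e) p₀ pR))))
    (hp : IsFragment (inputReply H) p) :
    C.machine = e ∧ p₀ C.centerPos = C.centerIdx ∧ pR C.radiusPos = C.radiusIdx ∧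
      p C.pointPos = C.pointIdx := by
  have hcode := eq_of_oracleReply_pair_eq_one hH hC.code
  have hcenter := eq_of_oracleReply_pair_eq_one hH hC.center
  have hradius := eq_of_oracleReply_pair_eq_one hH hC.radius
  rw [triple_zero] at hcode
  rw [triple_three_mul_add_one] at hcenter
  rw [triple_three_mul_add_two] at hradius
  refine ⟨?_, hcenter, hradius, hp _ _ hC.point⟩
  rw [Certificate.machine, ← hcode]
  exact Denumerable.ofNat_encode e

end Tape

section Approximation

variable {o : ℕ → Option ℕ} {X : Set ℕ} {e : Nat.Partrec.Code} {u : Sphere → ℝ} {D : Set Sphere}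
  {P : List (ℕ × ℕ)} {ε : ℚ} {d : Disk ℚ}

theorem CellCert.abs_sub_le {c : CellData} (hc : CellCert o e P ε d c)
    (ho : IsFragment o (bit X)) (hu : IsFunctionName X e D (realFun u)) {w : ℂ}
    (hw : ‖w - d.toReal.center‖ ≤ d.toReal.rad) (hwD : (w : Sphere) ∈ D) :
    |u w - ((gaussPoly P).eval w).re| ≤ ε := by
  obtain ⟨a, ha, haL⟩ := exists_isPointName_extending fun k hk =>
    (Disk.inBasic_toReal_iff.2 (hc.inBasic k hk)).coe_mem_basicSet hw
  obtain ⟨b, hb, hbu⟩ := hu w hwD a ha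
  have hmem : realFun u w ∈ basicSet c.2.1 := (hbu _).1 <| (hb.exists_eq_iff _).2
    ⟨_, exists_mem_run_of_mem_simulatedOutput ho haL hc.mem_output⟩
  obtain ⟨hlo, hhi, -, -⟩ := (coe_mem_basicSet_rect hc.isRect _).1 hmem
  rw [ofReal_re] at hlo hhi
  have hP := norm_eval_gaussPoly_sub_le hw P
  rw [polyDisk_toReal] at hP
  have hre := abs_le.1 ((Complex.abs_re_le_norm _).trans hP)
  simp only [sub_re, Disk.center, Disk.toReal] at hre
  have hεlo : ((polyDisk d P).re : ℝ) + (polyDisk d P).rad - reLo c.2.1 ≤ ε := by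
    exact_mod_cast hc.sub_reLo_le
  have hεhi : (reHi c.2.1 : ℝ) - ((polyDisk d P).re - (polyDisk d P).rad) ≤ ε := by
    exact_mod_cast hc.reHi_sub_le
  exact abs_le.2 ⟨by linarith, by linarith⟩

theorem exists_lt_abs_sub_mul_le {t h : ℝ} {N : ℕ} (hh : 0 < h) (ht : |t| ≤ N * h) :
    ∃ i < 2 * N + 1, |t - h * ((i : ℝ) - N)| ≤ h := by
  obtain ⟨htlo, hthi⟩ := abs_le.1 ht
  have hlo : 0 ≤ t / h + N := by
    have : -(N : ℝ) ≤ t / h := by rw [le_div_iff₀ hh]; linarith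
    linarith
  have hhi : t / h + N ≤ 2 * N := by
    have : t / h ≤ N := by rwa [div_le_iff₀ hh]
    linarith
  refine ⟨⌊t / h + N⌋₊, Nat.lt_succ_of_le (Nat.floor_le_of_le (by exact_mod_cast hhi)), ?_⟩
  have hsplit : t - h * ((⌊t / h + N⌋₊ : ℝ) - N) = h * (t / h + N - ⌊t / h + N⌋₊) := by
    field_simp
    ring
  rw [hsplit, abs_of_nonneg (mul_nonneg hh.le (sub_nonneg.2 (Nat.floor_le hlo)))]
  exact mul_le_of_le_one_right hh.le (by linarith [Nat.lt_floor_add_one (t / h + N)])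

theorem CoverCert.exists_near {b N : ℕ} {h : ℚ} (hc : CoverCert o b e P ε d h N) (hh : 0 < h)
    {w : ℂ} (hw : ‖w - d.toReal.center‖ ≤ d.toReal.rad) : ∃ g : Disk ℚ, ∃ c,
      CellCert o e P ε g c ∧ ‖w - g.toReal.center‖ ≤ g.toReal.rad := by
  have hh' : (0 : ℝ) < h := by exact_mod_cast hh
  have hrad : (d.rad : ℝ) ≤ N * h := by exact_mod_cast hc.rad_le
  obtain ⟨i, hi, hre⟩ := exists_lt_abs_sub_mul_le hh'
    (((Complex.abs_re_le_norm _).trans hw).trans hrad)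
  obtain ⟨j, hj, him⟩ := exists_lt_abs_sub_mul_le hh'
    (((Complex.abs_im_le_norm _).trans hw).trans hrad)
  have hnear : ‖w - (gridDisk d h N i j).toReal.center‖ ≤ (gridDisk d h N i j).toReal.rad := by
    refine (Complex.norm_le_abs_re_add_abs_im _).trans ?_
    simp only [gridDisk, Disk.toReal, Disk.center, sub_re, sub_im] at hre him ⊢
    push_cast
    rw [sub_sub] at hre him
    linarith
  rcases hc.exists_cellCert i hi j hj with hfar | ⟨n, -, hn⟩
  · have hclose : ‖(gridDisk d h N i j).toReal.center - d.toReal.center‖ ≤ d.rad + 2 * h := by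
      have hle := norm_sub_le_norm_sub_add_norm_sub (gridDisk d h N i j).toReal.center w
        d.toReal.center
      rw [norm_sub_rev _ w] at hle
      simp only [gridDisk, Disk.toReal, Rat.cast_mul, Rat.cast_ofNat] at hle hnear hw ⊢
      linarith
    have hsq := pow_le_pow_left₀ (norm_nonneg _) hclose 2
    rw [Complex.sq_norm, Complex.normSq_apply] at hsq
    simp only [gridDisk, Disk.toReal, Disk.center, sub_re, sub_im] at hsq
    push_cast at hsq
    rw [add_sub_cancel_left, add_sub_cancel_left, ← pow_two, ← pow_two] at hsq
    exact absurd hfar (not_lt.2 (by exact_mod_cast hsq))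
  · exact ⟨_, _, hn, hnear⟩

theorem CoverCert.abs_sub_le {b N : ℕ} {h : ℚ} (hc : CoverCert o b e P ε d h N) (hh : 0 < h)
    (ho : IsFragment o (bit X)) (hu : IsFunctionName X e D (realFun u)) {w : ℂ}
    (hw : ‖w - d.toReal.center‖ ≤ d.toReal.rad) (hwD : (w : Sphere) ∈ D) :
    |u w - ((gaussPoly P).eval w).re| ≤ ε := by
  obtain ⟨g, c, hgc, hg⟩ := hc.exists_near hh hw
  exact hgc.abs_sub_le ho hu hg hwD

end Approximation

theorem radiiFit_toReal_iff {d₀ d₁ : Disk ℚ} {a ρ σ ε τ : ℚ} :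
    RadiiFit d₀.toReal d₁.toReal (a : ℝ) ρ σ ε τ ↔ RadiiFit d₀ d₁ a ρ σ ε τ := by
  constructor <;> rintro ⟨h1, h2, h3, h4, h5, h6⟩
  · simp only [Disk.toReal] at h3 h4 h5 h6
    refine ⟨?_, ?_, ?_, ?_, ?_, ?_⟩ <;> assumption_mod_cast
  · refine ⟨Rat.cast_pos.2 h1, Rat.cast_pos.2 h2, ?_, ?_, ?_, ?_⟩ <;> simp only [Disk.toReal] <;>
      assumption_mod_cast

theorem conjugateDisk_toReal (d₀ d₁ : Disk ℚ) (P : List (ℕ × ℕ)) (τ : ℚ) :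
    conjugateDisk d₀.toReal d₁.toReal P (τ : ℝ) = (conjugateDisk d₀ d₁ P τ).toReal := by
  simp only [conjugateDisk, polyDisk_toReal]
  simp only [Disk.toReal, Rat.cast_sub, Rat.cast_add, Rat.cast_zero]

section Increment

variable {d₀ d₁ : Disk ℝ} {a ρ σ ε τ : ℝ} {z₀ z : ℂ} {F : ℂ → ℂ} {P : List (ℕ × ℕ)}

theorem RadiiFit.norm_sub_lt (h : RadiiFit d₀ d₁ a ρ σ ε τ) (hz₀ : ‖z₀ - d₀.center‖ ≤ d₀.rad)
    (hz : ‖z - d₁.center‖ ≤ d₁.rad) : ‖z - z₀‖ < σ + d₀.rad + d₁.rad := by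
  have hcenter : ‖d₁.center - d₀.center‖ < σ := by
    refine lt_of_pow_lt_pow_left₀ 2 h.sigma_pos.le ?_
    rw [Complex.sq_norm, Complex.normSq_apply, ← pow_two, ← pow_two]
    exact h.sq_lt_sq
  calc ‖z - z₀‖ = ‖(z - d₁.center) + (d₁.center - d₀.center) - (z₀ - d₀.center)‖ := by
        congr 1; ring
    _ ≤ ‖z - d₁.center‖ + ‖d₁.center - d₀.center‖ + ‖z₀ - d₀.center‖ :=
        (norm_sub_le _ _).trans (by gcongr; exact norm_add_le _ _)
    _ < σ + d₀.rad + d₁.rad := by linarith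

theorem RadiiFit.four_mul_div_le (h : RadiiFit d₀ d₁ a ρ σ ε τ)
    (hz₀ : ‖z₀ - d₀.center‖ ≤ d₀.rad) (hz : ‖z - d₁.center‖ ≤ d₁.rad) :
    4 * ε * ‖z - z₀‖ / (ρ - ‖z - z₀‖) ≤ τ := by
  have hdist := h.norm_sub_lt hz₀ hz
  have hρ := h.add_lt_rho
  have hε := h.eps_pos
  have hτ : 0 < τ := by
    have hρ0 : 0 < ρ := by linarith [norm_nonneg (z - z₀)]
    refine pos_of_mul_pos_left (b := ρ - σ - d₀.rad - d₁.rad) ?_ (by linarith)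
    exact lt_trans (by positivity) h.error_lt
  rw [div_le_iff₀ (by linarith)]
  calc 4 * ε * ‖z - z₀‖ ≤ 4 * ε * ρ := by gcongr; linarith
    _ ≤ τ * (ρ - σ - d₀.rad - d₁.rad) := h.error_lt.le
    _ ≤ τ * (ρ - ‖z - z₀‖) := mul_le_mul_of_nonneg_left (by linarith) hτ.le

theorem RadiiFit.norm_sub_center_conjugateDisk_le (h : RadiiFit d₀ d₁ a ρ σ ε τ)
    (hz₀ : ‖z₀ - d₀.center‖ ≤ d₀.rad) (hz : ‖z - d₁.center‖ ≤ d₁.rad)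
    (hF : DifferentiableOn ℂ F (Metric.ball z₀ ρ))
    (hP : ∀ w ∈ Metric.ball z₀ ρ, |(F w).re - ((gaussPoly P).eval w).re| ≤ ε) :
    ‖(((F z).im - (F z₀).im : ℝ) : ℂ) - (conjugateDisk d₀ d₁ P τ).center‖ ≤
      (conjugateDisk d₀ d₁ P τ).rad := by
  have hzρ : z ∈ Metric.ball z₀ ρ := by
    rw [mem_ball_iff_norm]
    linarith [h.norm_sub_lt hz₀ hz, h.add_lt_rho]
  have herror := abs_le.1 <| (abs_im_sub_im_le (f := fun w => F w - (gaussPoly P).eval w)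
    h.eps_pos (hF.sub (gaussPoly P).differentiable.differentiableOn) hP hzρ).trans
      (h.four_mul_div_le hz₀ hz)
  have h₀ := abs_le.1 ((Complex.abs_im_le_norm _).trans (norm_eval_gaussPoly_sub_le hz₀ P))
  have h₁ := abs_le.1 ((Complex.abs_im_le_norm _).trans (norm_eval_gaussPoly_sub_le hz P))
  have hcenter : (conjugateDisk d₀ d₁ P τ).center =
      (((polyDisk d₁ P).im - (polyDisk d₀ P).im : ℝ) : ℂ) := rfl
  simp only [sub_im, Disk.center] at herror h₀ h₁
  rw [hcenter, ← ofReal_sub, norm_real, Real.norm_eq_abs, abs_le]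
  constructor <;> simp only [conjugateDisk] <;> linarith

end Increment

theorem Certificate.Valid.mem_basicSet {C : Certificate} {H : List ℕ} {b k : ℕ} {X : Set ℕ}
    {e : Nat.Partrec.Code} {p₀ pR p : ℕ → ℕ} {u : Sphere → ℝ} {D : Set Sphere} {F : ℂ → ℂ}
    {z₀ z : ℂ} {R : ℝ} (hC : C.Valid H b k)
    (hH : IsFragment (oracleReply H) (bit (graphSet (triple (functionTape X e) p₀ pR))))
    (hin : IsFragment (inputReply H) p) (hu : IsFunctionName X e D (realFun u))
    (hD : ∀ w ∈ Metric.ball z₀ R, (w : Sphere) ∈ D)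
    (hF : DifferentiableOn ℂ F (Metric.ball z₀ R))
    (hFu : ∀ w ∈ Metric.ball z₀ R, u w = (F w).re)
    (hp₀ : IsPointName p₀ z₀) (hpR : IsPointName pR (R : ℂ)) (hp : IsPointName p z) :
    ((((F z).im - (F z₀).im : ℝ) : ℂ) : Sphere) ∈ basicSet k := by
  obtain ⟨hmachine, hcenter, hradius, hpoint⟩ := hC.readsTape.eq hH hin
  obtain ⟨hrect₀, hrectR, hrect₁⟩ := hC.isRect
  have hz₀ := norm_sub_center_boundingDisk_le hrect₀ ((hp₀ _).1 ⟨_, hcenter⟩)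
  have hz := norm_sub_center_boundingDisk_le hrect₁ ((hp _).1 ⟨_, hpoint⟩)
  have hR := ((coe_mem_basicSet_rect hrectR _).1 ((hpR _).1 ⟨_, hradius⟩)).1
  rw [ofReal_re] at hR
  have hfit := radiiFit_toReal_iff.2 hC.radiiFit
  have hρ := hfit.add_rad_lt
  have hrad := (norm_nonneg _).trans hz₀
  have hsub : Metric.ball z₀ C.ρ ⊆ Metric.ball z₀ R := Metric.ball_subset_ball (by linarith)
  have happrox : ∀ w ∈ Metric.ball z₀ C.ρ, |(F w).re - ((gaussPoly C.poly).eval w).re| ≤ C.ε := by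
    intro w hw
    rw [← hFu w (hsub hw)]
    refine (hmachine ▸ hC.coverCert).abs_sub_le hC.h_pos (isFragment_knownOracle hH) hu ?_
      (hD w (hsub hw))
    rw [mem_ball_iff_norm] at hw
    have hle := norm_sub_le_norm_sub_add_norm_sub w z₀ (boundingDisk C.centerIdx).toReal.center
    refine hle.trans ((add_le_add hw.le hz₀).trans_eq ?_)
    simp only [boundingDisk, Disk.toReal, Rat.cast_add]
  refine Disk.InBasic.coe_mem_basicSet (Disk.inBasic_toReal_iff.2 hC.inBasic) ?_
  rw [← conjugateDisk_toReal]
  exact hfit.norm_sub_center_conjugateDisk_le hz₀ hz (hF.mono hsub) happrox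

/-! ### Completeness of certificates -/

section Completeness

open Filter Topology

section Cover

variable {X : Set ℕ} {e : Nat.Partrec.Code} {u : Sphere → ℝ} {D : Set Sphere} {P : List (ℕ × ℕ)}
  {ε : ℚ}

theorem exists_cellCert_near (hu : IsFunctionName X e D (realFun u)) {w : ℂ}
    (hw : (w : Sphere) ∈ D) (hP : |u w - ((gaussPoly P).eval w).re| < ε) :
    ∃ c b, ∃ δ > 0, ∀ d : Disk ℚ, ‖d.toReal.center - w‖ < δ → |d.toReal.rad| < δ →
      ∀ o, CoversUpTo o (bit X) b → CellCert o e P ε d c := by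
  obtain ⟨hPlo, hPhi⟩ := abs_lt.1 hP
  obtain ⟨α, hα, hαu⟩ := exists_rat_btwn (show ((gaussPoly P).eval w).re - ε < u w by linarith)
  obtain ⟨β, huβ, hβ⟩ := exists_rat_btwn (show u w < ((gaussPoly P).eval w).re + ε by linarith)
  obtain ⟨k, hk, rfl, rfl, him⟩ := exists_rect_index α β (-1) 1
  obtain ⟨a, ha, -⟩ := exists_isPointName_extending (L := []) (w := w) (by simp)
  obtain ⟨q, hq, hqu⟩ := hu w hw a ha
  have hku : realFun u w ∈ basicSet k :=
    (coe_mem_basicSet_rect hk _).2 (by simpa [him.1, him.2] using ⟨hαu, huβ⟩)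
  obtain ⟨t, C, hC, hkC⟩ := (hq.exists_eq_iff k).1 ((hqu k).2 hku)
  obtain ⟨m, hm⟩ := exists_forall_mem_simulatedOutput hC hkC
  have hlist : ∀ᶠ d in 𝓝 (Disk.ofPoint w), ∀ j ∈ (List.range (m + 1)).map a, d.InBasic j := by
    simp only [← List.mem_toFinset]
    refine (Filter.eventually_all_finset _).2 fun j hj => Disk.eventually_inBasic ((ha j).1 ?_)
    obtain ⟨i, -, hi⟩ := List.mem_map.1 (List.mem_toFinset.1 hj)
    exact ⟨i, hi⟩
  have hlo : ∀ᶠ d in 𝓝 (Disk.ofPoint w),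
      (polyDisk d P).re + (polyDisk d P).rad - (reLo k : ℝ) < ε :=
    (Continuous.continuousAt (by fun_prop)).eventually_lt_const <| by
      rw [polyDisk_ofPoint]; simp only [Disk.ofPoint]; linarith
  have hhi : ∀ᶠ d in 𝓝 (Disk.ofPoint w),
      (reHi k : ℝ) - ((polyDisk d P).re - (polyDisk d P).rad) < ε :=
    (Continuous.continuousAt (by fun_prop)).eventually_lt_const <| by
      rw [polyDisk_ofPoint]; simp only [Disk.ofPoint]; linarith
  obtain ⟨δ, hδ, hd⟩ :=
    Disk.exists_forall_of_eventually_nhds_ofPoint (hlist.and (hlo.and hhi))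
  refine ⟨((List.range (m + 1)).map a, k, m, t), m, δ, hδ, fun d hdw hdr o ho => ?_⟩
  obtain ⟨hL, h1, h2⟩ := hd d.toReal hdw hdr
  rw [polyDisk_toReal] at h1 h2
  simp only [Disk.toReal] at h1 h2
  refine ⟨fun j hj => Disk.inBasic_toReal_iff.1 (hL j hj), hm _ _ _ le_rfl ho fun i hi => ?_, hk,
    ?_, ?_⟩
  · simp [Nat.lt_succ_of_le hi]
  · exact le_of_lt (by exact_mod_cast h1)
  · exact le_of_lt (by exact_mod_cast h2)

theorem exists_forall_cellCert (hu : IsFunctionName X e D (realFun u)) {K : Set ℂ}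
    (hK : IsCompact K) (hKD : ∀ w ∈ K, (w : Sphere) ∈ D)
    (hP : ∀ w ∈ K, |u w - ((gaussPoly P).eval w).re| < ε) :
    ∃ δ > 0, ∃ b, ∀ d : Disk ℚ, d.toReal.center ∈ K → |d.toReal.rad| < δ →
      ∀ o, CoversUpTo o (bit X) b →
        ∃ w < b, CellCert o e P ε d (Denumerable.ofNat CellData w) := by
  refine hK.induction_on ⟨1, one_pos, 0, by simp⟩ ?_ ?_ ?_
  · rintro s t hst ⟨δ, hδ, b, h⟩
    exact ⟨δ, hδ, b, fun d hd => h d (hst hd)⟩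
  · rintro s t ⟨δ, hδ, b, h⟩ ⟨δ', hδ', b', h'⟩
    refine ⟨min δ δ', lt_min hδ hδ', max b b', fun d hd hr o ho => ?_⟩
    obtain ⟨hr, hr'⟩ := lt_min_iff.1 hr
    rcases hd with hd | hd
    · obtain ⟨w, hw, hc⟩ := h d hd hr o (ho.mono (le_max_left _ _))
      exact ⟨w, lt_max_of_lt_left hw, hc⟩
    · obtain ⟨w, hw, hc⟩ := h' d hd hr' o (ho.mono (le_max_right _ _))
      exact ⟨w, lt_max_of_lt_right hw, hc⟩
  · intro w hw
    obtain ⟨c, b, δ, hδ, h⟩ := exists_cellCert_near hu (hKD w hw) (hP w hw)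
    refine ⟨Metric.ball w δ, mem_nhdsWithin_of_mem_nhds (Metric.ball_mem_nhds w hδ), δ, hδ,
      max b (Encodable.encode c + 1), fun d hd hr o ho => ?_⟩
    refine ⟨Encodable.encode c, lt_max_of_lt_right (Nat.lt_succ_self _), ?_⟩
    rw [Denumerable.ofNat_encode]
    exact h d (mem_ball_iff_norm.1 hd) hr o (ho.mono (le_max_left _ _))

theorem norm_center_gridDisk_sub_le {d : Disk ℚ} {h : ℚ} {N i j : ℕ} (hd : 0 ≤ d.rad + 2 * h)
    (hnear : (h * ((i : ℚ) - N)) ^ 2 + (h * ((j : ℚ) - N)) ^ 2 ≤ (d.rad + 2 * h) ^ 2) :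
    ‖(gridDisk d h N i j).toReal.center - d.toReal.center‖ ≤ (d.rad + 2 * h : ℚ) := by
  refine le_of_sq_le_sq ?_ (by exact_mod_cast hd)
  rw [Complex.sq_norm, Complex.normSq_apply]
  simp only [gridDisk, Disk.toReal, Disk.center, sub_re, sub_im]
  rw [← pow_two, ← pow_two, ← Rat.cast_sub, ← Rat.cast_sub, add_sub_cancel_left,
    add_sub_cancel_left]
  exact_mod_cast hnear

theorem exists_coverCert (hu : IsFunctionName X e D (realFun u)) {z₀ : ℂ} {ρ a : ℝ} (hρ : ρ < a)
    (hD : ∀ w ∈ Metric.closedBall z₀ a, (w : Sphere) ∈ D)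
    (hP : ∀ w ∈ Metric.closedBall z₀ a, |u w - ((gaussPoly P).eval w).re| < ε) :
    ∃ h > 0, ∃ b, ∃ η > 0, ∀ d : Disk ℚ, 0 ≤ d.rad → ‖d.toReal.center - z₀‖ < η →
      d.rad < ρ + η → ∃ N, ∀ o, CoversUpTo o (bit X) b → ∀ B ≥ b, CoverCert o B e P ε d h N := by
  obtain ⟨δ, hδ, b, hcell⟩ :=
    exists_forall_cellCert hu (isCompact_closedBall z₀ a) hD hP
  obtain ⟨h, hh, hhlt⟩ := exists_rat_btwn (show 0 < min (δ / 2) ((a - ρ) / 4) from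
    lt_min (by linarith) (by linarith))
  obtain ⟨hhδ, hha⟩ := lt_min_iff.1 hhlt
  have hh0 : 0 < h := by exact_mod_cast hh
  refine ⟨h, hh0, b, (a - ρ) / 4, by linarith, fun d hd0 hdz hdρ => ?_⟩
  obtain ⟨N, hN⟩ := exists_nat_ge (d.rad / h)
  refine ⟨N, fun o ho B hB => ⟨(div_le_iff₀ hh0).1 hN, fun i _ j _ => ?_⟩⟩
  refine or_iff_not_imp_left.2 fun hnear => ?_
  have hcenter := norm_center_gridDisk_sub_le (by positivity) (not_lt.1 hnear)
  have hball : (gridDisk d h N i j).toReal.center ∈ Metric.closedBall z₀ a := by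
    rw [mem_closedBall_iff_norm]
    refine (norm_sub_le_norm_sub_add_norm_sub _ d.toReal.center _).trans ?_
    push_cast at hcenter
    linarith
  have hrad : |(gridDisk d h N i j).toReal.rad| < δ := by
    simp only [gridDisk, Disk.toReal, Rat.cast_mul, Rat.cast_ofNat]
    rw [abs_of_pos (by linarith)]
    linarith
  obtain ⟨w, hw, hc⟩ := hcell _ hball hrad o ho
  exact ⟨w, hw.trans_le hB, hc⟩

end Cover

section Parameters

variable {z₀ z : ℂ} {k : ℕ}

theorem radiiFit_ofPoint {a ρ σ ε τ : ℝ} (hε : 0 < ε) (hρ : ρ < a) (hz : ‖z - z₀‖ < σ)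
    (hσρ : σ < ρ) (hετ : 4 * ε * ρ < τ * (ρ - σ)) :
    RadiiFit (Disk.ofPoint z₀) (Disk.ofPoint z) a ρ σ ε τ := by
  have hsq := pow_lt_pow_left₀ hz (norm_nonneg _) two_ne_zero
  rw [Complex.sq_norm, Complex.normSq_apply, ← pow_two, ← pow_two] at hsq
  refine ⟨hε, (norm_nonneg _).trans_lt hz, ?_, hsq, ?_, ?_⟩ <;> simpa [Disk.ofPoint]

theorem RadiiFit.eventually_nhds {d₀ d₁ : Disk ℝ} {a ρ σ ε τ : ℝ}
    (h : RadiiFit d₀ d₁ a ρ σ ε τ) :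
    ∀ᶠ q in 𝓝 (d₀, d₁), RadiiFit q.1 q.2 a ρ σ ε τ := by
  have hlt : ∀ {f : Disk ℝ × Disk ℝ → ℝ} {x : ℝ}, Continuous f → f (d₀, d₁) < x →
      ∀ᶠ q in 𝓝 (d₀, d₁), f q < x := fun hf => hf.continuousAt.eventually_lt_const
  have hgt : ∀ᶠ q in 𝓝 (d₀, d₁), 4 * ε * ρ < τ * (ρ - σ - q.1.rad - q.2.rad) :=
    (Continuous.continuousAt (by fun_prop)).eventually_const_lt h.error_lt
  filter_upwards [hgt, hlt (f := fun q => ρ + 2 * q.1.rad) (by fun_prop) h.add_rad_lt,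
    hlt (f := fun q => (q.2.re - q.1.re) ^ 2 + (q.2.im - q.1.im) ^ 2) (by fun_prop) h.sq_lt_sq,
    hlt (f := fun q => σ + q.1.rad + q.2.rad) (by fun_prop) h.add_lt_rho] with q h1 h2 h3 h4
  exact ⟨h.eps_pos, h.sigma_pos, h2, h3, h4, h1⟩

theorem conjugateDisk_ofPoint (z₀ z : ℂ) (P : List (ℕ × ℕ)) (τ : ℝ) :
    conjugateDisk (Disk.ofPoint z₀) (Disk.ofPoint z) P τ =
      ⟨((gaussPoly P).eval z).im - ((gaussPoly P).eval z₀).im, 0, τ⟩ := by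
  simp only [conjugateDisk, polyDisk_ofPoint]
  simp only [Disk.ofPoint, zero_add]

theorem exists_forall_eventually_inBasic_conjugateDisk {x : ℝ}
    (hx : ((x : ℂ) : Sphere) ∈ basicSet k) :
    ∃ δ > 0, ∀ (P : List (ℕ × ℕ)) (τ : ℝ) (z₀ z : ℂ),
      |((gaussPoly P).eval z).im - ((gaussPoly P).eval z₀).im - x| < δ → |τ| < δ →
      ∀ᶠ q in 𝓝 (Disk.ofPoint z₀, Disk.ofPoint z), (conjugateDisk q.1 q.2 P τ).InBasic k := by
  obtain ⟨δ, hδ, h⟩ := Disk.exists_forall_of_eventually_nhds_ofPoint (Disk.eventually_inBasic hx)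
  refine ⟨δ, hδ, fun P τ z₀ z hP hτ => ?_⟩
  have hcont : Continuous fun q : Disk ℝ × Disk ℝ => conjugateDisk q.1 q.2 P τ := by
    unfold conjugateDisk; fun_prop
  refine hcont.continuousAt.eventually ((Disk.isOpen_setOf_inBasic k).mem_nhds ?_)
  change (conjugateDisk (Disk.ofPoint z₀) (Disk.ofPoint z) P τ).InBasic k
  rw [conjugateDisk_ofPoint]
  refine h _ ?_ hτ
  change ‖((_ : ℝ) : ℂ) - x‖ < δ
  rwa [← ofReal_sub, norm_real]

theorem exists_rat_radii {t R : ℝ} (htR : t < R) : ∃ ρ σ : ℚ, t < σ ∧ (σ : ℝ) < ρ ∧ ρ < R := by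
  obtain ⟨σ, htσ, hσR⟩ := exists_rat_btwn htR
  obtain ⟨ρ, hσρ, hρR⟩ := exists_rat_btwn hσR
  exact ⟨ρ, σ, htσ, hσρ, hρR⟩

theorem exists_gaussPoly_re_im_near {F : ℂ → ℂ} {c : ℂ} {r R ε δ : ℝ} (hr : 0 < r) (hrR : r < R)
    (hF : DifferentiableOn ℂ F (Metric.ball c R)) (hε : 0 < ε) (hδ : 0 < δ) :
    ∃ P : List (ℕ × ℕ),
      (∀ w ∈ Metric.closedBall c r, |(F w).re - ((gaussPoly P).eval w).re| < ε) ∧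
      ∀ᵉ (v ∈ Metric.closedBall c r) (w ∈ Metric.closedBall c r),
        |((gaussPoly P).eval w).im - ((gaussPoly P).eval v).im - ((F w).im - (F v).im)| < δ := by
  obtain ⟨P, hP⟩ :=
    exists_gaussPoly_near_of_differentiableOn hr hrR hF (lt_min hε (half_pos hδ))
  refine ⟨P, fun w hw =>
    (Complex.abs_re_le_norm _).trans_lt ((hP w hw).trans_le (min_le_left _ _)), ?_⟩
  have him : ∀ w ∈ Metric.closedBall c r, |(F w).im - ((gaussPoly P).eval w).im| < δ / 2 :=
    fun w hw => (Complex.abs_im_le_norm _).trans_lt ((hP w hw).trans_le (min_le_right _ _))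
  intro v hv w hw
  have hv := abs_lt.1 (him v hv)
  have hw := abs_lt.1 (him w hw)
  exact abs_lt.2 ⟨by linarith, by linarith⟩

theorem exists_eventually_radiiFit_and_inBasic {F : ℂ → ℂ} {R : ℝ}
    (hF : DifferentiableOn ℂ F (Metric.ball z₀ R)) (hz : z ∈ Metric.ball z₀ R)
    (hk : ((((F z).im - (F z₀).im : ℝ) : ℂ) : Sphere) ∈ basicSet k) :
    ∃ kR, kR.unpair.1 ≠ 0 ∧ ((R : ℂ) : Sphere) ∈ basicSet kR ∧
      ∃ ρ σ ε τ : ℚ, 0 < ρ ∧ ρ < reLo kR ∧ ∃ P : List (ℕ × ℕ),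
        (∀ w ∈ Metric.closedBall z₀ (reLo kR), |(F w).re - ((gaussPoly P).eval w).re| < ε) ∧
        ∀ᶠ q in 𝓝 (Disk.ofPoint z₀, Disk.ofPoint z),
          RadiiFit q.1 q.2 (reLo kR : ℝ) ρ σ ε τ ∧ (conjugateDisk q.1 q.2 P (τ : ℝ)).InBasic k := by
  rw [mem_ball_iff_norm] at hz
  obtain ⟨ρ, σ, hzσ, hσρ, hρR⟩ := exists_rat_radii hz
  have hσ : (0 : ℝ) < σ := (norm_nonneg _).trans_lt hzσ
  have hρ : (0 : ℝ) < ρ := hσ.trans hσρ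
  obtain ⟨kR, hkR, hRkR, hρa⟩ : ∃ kR, kR.unpair.1 ≠ 0 ∧ ((R : ℂ) : Sphere) ∈ basicSet kR ∧
      (ρ : ℝ) < (boundingDisk kR).toReal.re :=
    Disk.exists_boundingDisk_of_eventually_nhds_ofPoint <|
      (Continuous.continuousAt (by fun_prop)).eventually_const_lt (by simpa [Disk.ofPoint])
  obtain ⟨δ, hδ, hdisk⟩ := exists_forall_eventually_inBasic_conjugateDisk hk
  obtain ⟨τ, hτ, hτδ⟩ := exists_rat_btwn hδ
  obtain ⟨ε, hε, hετ⟩ := exists_rat_btwn (show (0 : ℝ) < τ * (ρ - σ) / (4 * ρ) from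
    div_pos (mul_pos hτ (sub_pos.2 hσρ)) (by linarith))
  rw [lt_div_iff₀ (by linarith)] at hετ
  have haR := ((coe_mem_basicSet_rect hkR _).1 hRkR).1
  rw [ofReal_re] at haR
  obtain ⟨P, hre, him⟩ := exists_gaussPoly_re_im_near (hρ.trans hρa) haR hF hε hδ
  have hza : z ∈ Metric.closedBall z₀ (reLo kR : ℝ) :=
    mem_closedBall_iff_norm.2 ((hzσ.trans hσρ).trans hρa).le
  refine ⟨kR, hkR, hRkR, ρ, σ, ε, τ, Rat.cast_pos.1 hρ, Rat.cast_lt.1 hρa, P, hre, ?_⟩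
  exact (radiiFit_ofPoint hε hρa hzσ hσρ (by linarith)).eventually_nhds.and
    (hdisk P τ z₀ z (him z₀ (Metric.mem_closedBall_self (hρ.trans hρa).le) z hza)
      (by rwa [abs_of_pos hτ]))

end Parameters

section Validity

variable {X : Set ℕ} {e : Nat.Partrec.Code} {p₀ pR p : ℕ → ℕ}

theorem Certificate.exists_forall_readsTape {C : Certificate}
    (hcode : Encodable.encode e = C.code) (hcenter : p₀ C.centerPos = C.centerIdx)
    (hradius : pR C.radiusPos = C.radiusIdx) (hpoint : p C.pointPos = C.pointIdx) :
    ∃ b, ∀ H, CoversUpTo (oracleReply H) (bit (graphSet (triple (functionTape X e) p₀ pR))) b →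
      CoversUpTo (inputReply H) p b → C.ReadsTape H := by
  refine ⟨max (max (Nat.pair 0 C.code) (Nat.pair (3 * C.centerPos + 1) C.centerIdx))
    (max (Nat.pair (3 * C.radiusPos + 2) C.radiusIdx) C.pointPos), fun H hH hin => ?_⟩
  refine ⟨oracleReply_pair_eq_one hH hcode (by simp), oracleReply_pair_eq_one hH ?_ (by simp),
    oracleReply_pair_eq_one hH ?_ (by simp), ?_⟩
  · rw [triple_three_mul_add_one, hcenter]
  · rw [triple_three_mul_add_two, hradius]
  · rw [hin _ (by simp), hpoint]

variable {u : Sphere → ℝ} {D : Set Sphere} {F : ℂ → ℂ} {z₀ z : ℂ} {R : ℝ} {k : ℕ}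

theorem exists_eventually_valid (hu : IsFunctionName X e D (realFun u))
    (hD : ∀ w ∈ Metric.ball z₀ R, (w : Sphere) ∈ D)
    (hF : DifferentiableOn ℂ F (Metric.ball z₀ R))
    (hFu : ∀ w ∈ Metric.ball z₀ R, u w = (F w).re)
    (hp₀ : IsPointName p₀ z₀) (hpR : IsPointName pR (R : ℂ)) (hp : IsPointName p z)
    (hz : z ∈ Metric.ball z₀ R)
    (hk : ((((F z).im - (F z₀).im : ℝ) : ℂ) : Sphere) ∈ basicSet k) :
    ∃ (C : Certificate) (b : ℕ), ∀ H B, b ≤ B →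
      CoversUpTo (oracleReply H) (bit (graphSet (triple (functionTape X e) p₀ pR))) B →
      CoversUpTo (inputReply H) p B → C.Valid H B k := by
  obtain ⟨kR, hkR, hRkR, ρ, σ, ε, τ, hρ, hρa, P, hP, hev⟩ :=
    exists_eventually_radiiFit_and_inBasic hF hz hk
  have haR := ((coe_mem_basicSet_rect hkR _).1 hRkR).1
  rw [ofReal_re] at haR
  have hball := Metric.closedBall_subset_ball (x := z₀) haR
  obtain ⟨h, hh, b, η, hη, hcover⟩ := exists_coverCert hu (Rat.cast_lt.2 hρa)
    (fun w hw => hD w (hball hw)) (fun w hw => by rw [hFu w (hball hw)]; exact hP w hw)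
  have hsmall : ∀ᶠ d in 𝓝 (Disk.ofPoint z₀), ‖d.center - z₀‖ < η ∧ d.rad < η :=
    ((Continuous.continuousAt (by fun_prop)).eventually_lt_const
      (by change ‖z₀ - z₀‖ < η; rwa [sub_self, norm_zero])).and
      ((Continuous.continuousAt (by fun_prop)).eventually_lt_const hη)
  obtain ⟨k₀, hk₀, hzk₀, hk₀small, hev₁⟩ :=
    Disk.exists_boundingDisk_of_eventually_nhds_ofPoint (hsmall.and hev.curry_nhds)
  obtain ⟨k₁, hk₁, hzk₁, hfit, hin⟩ := Disk.exists_boundingDisk_of_eventually_nhds_ofPoint hev₁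
  have hrad : (0 : ℝ) ≤ halfPerimeter k₀ :=
    (norm_nonneg _).trans (norm_sub_center_boundingDisk_le hk₀ hzk₀)
  obtain ⟨N, hN⟩ := hcover ⟨reLo k₀, imLo k₀, ρ + halfPerimeter k₀⟩
    (add_nonneg hρ.le (by exact_mod_cast hrad)) hk₀small.1
    (by push_cast; exact add_lt_add_right hk₀small.2 _)
  obtain ⟨i₀, hi₀⟩ := (hp₀ k₀).2 hzk₀
  obtain ⟨iR, hiR⟩ := (hpR kR).2 hRkR
  obtain ⟨i₁, hi₁⟩ := (hp k₁).2 hzk₁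
  let C : Certificate := ⟨Encodable.encode e, i₀, k₀, iR, kR, i₁, k₁, P, ρ, σ, ε, τ, h, N⟩
  obtain ⟨b', hb'⟩ := Certificate.exists_forall_readsTape (X := X) (C := C) rfl hi₀ hiR hi₁
  refine ⟨C, max b' (Nat.pair (3 * b + 3) 1), fun H B hB hH hpB => ?_⟩
  obtain ⟨hB', hB⟩ := max_le_iff.1 hB
  refine ⟨hb' H (hH.mono hB') (hpB.mono hB'), ⟨hk₀, hkR, hk₁⟩, hh, radiiFit_toReal_iff.1 hfit, ?_,
    Disk.inBasic_toReal_iff.1 (conjugateDisk_toReal _ _ _ _ ▸ hin)⟩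
  rw [Certificate.machine, Denumerable.ofNat_encode]
  refine hN _ (coversUpTo_knownOracle (hH.mono hB)) B (le_trans ?_ hB)
  exact le_trans (by omega) (Nat.left_le_pair _ _)

end Validity

end Completeness

/-! ### The conjugation machine -/

/-- The function `Im F - Im F z₀` on the extended plane, with value `0` at `∞`: the harmonic
conjugate of `Re F` that vanishes at `z₀`, where `F` is holomorphic. -/
noncomputable def conjugateOf (F : ℂ → ℂ) (z₀ : ℂ) (s : Sphere) : ℝ :=
  s.elim 0 fun z => (F z).im - (F z₀).im

theorem exists_conjugation_machine :
    ∃ e' : Nat.Partrec.Code, ∀ (u : Sphere → ℝ) (D : Set Sphere) (F : ℂ → ℂ) (z₀ : ℂ) (R : ℝ)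
      (X : Set ℕ) (e : Nat.Partrec.Code) (p₀ pR : ℕ → ℕ),
      (∀ w ∈ Metric.ball z₀ R, (w : Sphere) ∈ D) →
      DifferentiableOn ℂ F (Metric.ball z₀ R) →
      (∀ w ∈ Metric.ball z₀ R, u w = (F w).re) →
      IsFunctionName X e D (realFun u) → IsPointName p₀ z₀ → IsPointName pR (R : ℂ) →
      IsFunctionName (graphSet (triple (functionTape X e) p₀ pR)) e'
        ((fun z : ℂ => (z : Sphere)) '' Metric.ball z₀ R) (realFun (conjugateOf F z₀)) := by
  obtain ⟨e', he'⟩ := exists_search_machine Certificate.primrecPred_valid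
  refine ⟨e', fun u D F z₀ R X e p₀ pR hD hF hFu hu hp₀ hpR => ?_⟩
  rintro _ ⟨z, hz, rfl⟩ p hp
  refine he' _ p {k | realFun (conjugateOf F z₀) z ∈ basicSet k}
    (infinite_setOf_mem_basicSet _)
    (fun H s hH hin hs => hs.mem_basicSet hH hin hu hD hF hFu hp₀ hpR hp) fun k hk => ?_
  obtain ⟨C, b, hC⟩ := exists_eventually_valid hu hD hF hFu hp₀ hpR hp hz hk
  obtain ⟨n, rfl⟩ := Certificate.ofNat_surjective C
  refine ⟨Nat.pair k (Nat.pair n b), by simp, fun H hH hin => ?_⟩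
  have hb : b ≤ Nat.pair k (Nat.pair n b) :=
    (Nat.right_le_pair n b).trans (Nat.right_le_pair k _)
  simpa only [Nat.unpair_pair] using hC H b le_rfl (hH.mono hb) (hin.mono hb)

end ComputableConjugation

theorem mainTheorem10_general :
    ∃ M : Nat.Partrec.Code, ∀ (u : Sphere → ℝ) (D : Set Sphere) (z₀ : ℂ) (R : ℝ),
      HarmonicOnNhd (fun z : ℂ => u z) (Metric.ball z₀ R) →
      (∀ z ∈ Metric.ball z₀ R, (z : Sphere) ∈ D) →
      ∃ v : Sphere → ℝ,
        IsHarmonicConjugateOn (fun z : ℂ => u z) (fun z : ℂ => v z) (Metric.ball z₀ R) ∧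
        v z₀ = 0 ∧
        (∀ z ∈ Metric.ball z₀ R, ∀ r : ℝ, ‖z - z₀‖ < r → r < R →
          ((v z : ℝ) : ℂ) = conjugatePoisson (fun w : ℂ => u w) z₀ r z) ∧
        ∀ (X : Set ℕ) (e : Nat.Partrec.Code) (p₀ pR : ℕ → ℕ),
          IsFunctionName X e D (realFun u) → IsPointName p₀ z₀ → IsPointName pR (R : ℂ) →
          ∃ (Y : Set ℕ) (e' : Nat.Partrec.Code),
            Writes M ∅ (triple (functionTape X e) p₀ pR) (functionTape Y e') ∧
            IsFunctionName Y e' ((fun z : ℂ => (z : Sphere)) '' Metric.ball z₀ R)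
              (realFun v) := by
  obtain ⟨e', he'⟩ := exists_conjugation_machine
  obtain ⟨M, hM⟩ := exists_copy_machine e'
  refine ⟨M, fun u D z₀ R hu hD => ?_⟩
  obtain ⟨F, hF, hFre⟩ := hu.exists_analyticOnNhd_ball_re_eq
  have hFu : ∀ w ∈ Metric.ball z₀ R, u w = (F w).re := fun w hw => (hFre hw).symm
  refine ⟨conjugateOf F z₀, isHarmonicConjugateOn_re_im Metric.isOpen_ball hF hFu fun _ _ => rfl,
    sub_self _, fun z _ r hzr hrR => ?_, fun X e p₀ pR hX hp₀ hpR =>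
      ⟨_, e', hM _ _, he' u D F z₀ R X e p₀ pR hD hF.differentiableOn hFu hX hp₀ hpR⟩⟩
  have hsub : Metric.closedBall z₀ r ⊆ Metric.ball z₀ R := Metric.closedBall_subset_ball hrR
  exact im_sub_im_eq_conjugatePoisson (hF.mono hsub) (fun w hw => hFu w (hsub hw))
    (mem_ball_iff_norm.2 hzr)

theorem mainTheorem10 :
    -- one machine `M`, without oracle, for all data
    ∃ M : Nat.Partrec.Code,
      ∀ (u : Sphere → ℝ) (D : Set Sphere),
        IsHarmonicOn u D →
      ∀ (z₀ : ℂ) (R : ℝ), 0 < R →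
        (∀ z ∈ Metric.closedBall z₀ R, (z : Sphere) ∈ D) →
      ∃ v : Sphere → ℝ,
        -- `v` is the harmonic conjugate of `u` on the disk that vanishes at its center
        IsHarmonicConjugateOn
          (fun z : ℂ => u (z : Sphere))
          (fun z : ℂ => v (z : Sphere)) (Metric.ball z₀ R) ∧
        v (z₀ : Sphere) = 0 ∧
        -- it is given by the conjugate Poisson integral
        (∀ z ∈ Metric.ball z₀ R, ∀ r : ℝ, ‖z - z₀‖ < r → r < R →
          ((v (z : Sphere) : ℝ) : ℂ) =
            conjugatePoisson
              (fun w : ℂ => u (w : Sphere)) z₀ r z) ∧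
        -- from names of `u`, `z₀`, `R`, the machine `M` writes a name of `v`
        ∀ (X : Set ℕ) (e : Nat.Partrec.Code) (p₀ pR : ℕ → ℕ),
          IsFunctionName X e D (realFun u) →
          IsPointName p₀ (z₀ : Sphere) →
          IsPointName pR ((R : ℂ) : Sphere) →
          ∃ (Y : Set ℕ) (e' : Nat.Partrec.Code),
            Writes M ∅
              (triple (functionTape X e) p₀ pR)
              (functionTape Y e') ∧
            IsFunctionName Y e'
              ((fun z : ℂ => (z : Sphere)) '' Metric.ball z₀ R)
              (realFun v) := by
  obtain ⟨M, hM⟩ := mainTheorem10_general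
  refine ⟨M, fun u D hu z₀ R _ hD => ?_⟩
  have hball : ∀ z ∈ Metric.ball z₀ R, (z : Sphere) ∈ D := fun z hz =>
    hD z (Metric.ball_subset_closedBall hz)
  exact hM u D z₀ R (hu.finite.mono hball) hball
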